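/- **Notation.** For $w=se^{i\varphi}$ with $s\ge 0$, $-\pi<\varphi\le\pi$, write $w^{1/n}=s^{1/n}e^{i\varphi/n}$ (and $\sqrt{w}=w^{1/2}$). For integers $n\ge 3$, $r\ge 0$ let $X_{n,r}(x)={}_2F_1(-r,-r-1/n;1-1/n;x)$, let $D_{n,r}$ be the smallest positive integer such that $D_{n,r}X_{n,r}(x)$ has integer coefficients, and for a positive integer $d$ let $N_{d,n,r}$ be the greatest common divisor of the numerators of the coefficients of $X_{n,r}(1-dx)$. Put $\mathcal N_{d,n}=\prod_{p\mid n}p^{\min(v_p(d),\,v_p(n)+1/(p-1))}$, the product being over the primes $p$ dividing $n$. **Setting.** Let $\mathbb K\subset\mathbb C$ be an imaginary quadratic field and let $\beta_1$ be an algebraic integer with $[\mathbb K(\beta_1):\mathbb K]\le 2$. - If $\beta_1\in\mathbb K$, let $\tau=1$, let $\beta_2\in\mathbb K$ be an algebraic integer with $\beta_2\ne\beta_1$, and let $\gamma_1,\gamma_2\in\mathbb K$ be non-zero. - If $[\mathbb K(\beta_1):\mathbb K]=2$, let $\tau\in\mathbb K$ be an algebraic integer with $\mathbb K(\beta_1)=\mathbb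 K(\sqrt{\tau})$, let $\beta_2$ be the algebraic conjugate of $\beta_1$ over $\mathbb K$, let $\gamma_1\in\mathbb K(\beta_1)$, and let $\gamma_2$ be the algebraic conjugate of $\gamma_1$ over $\mathbb K$ (the image of $\gamma_1$ under the non-trivial $\mathbb K$-automorphism of $\mathbb K(\beta_1)$, so $\gamma_2=\gamma_1$ if $\gamma_1\in\mathbb K$). For an algebraic integer $x\in\mathbb K$ and an integer $n\ge 3$ put $$U=-\gamma_2(x-\beta_2)^n,\qquad Z=\gamma_1(x-\beta_1)^n,\qquad W=\frac ZU,\qquad \mathcal A=\frac{\beta_1(x-\beta_2)W^{1/n}-\beta_2(x-\beta_1)}{(x-\beta_2)W^{1/n}-(x-\beta_1)}.$$ Let $g$ be a non-zero algebraic number such that $U/g$ and $Z/g$ are algebraic integers. For each integer $r\ge 0$ let $h_r$ be a non-zero algebraic integer with $h_r/g^r\in\mathbb K$ and $|h_r|\le h$, for some fixed real $h>0$. Suppose that there is a largest positive rational integer $d$ such that $(U-Z)/(dg)$ is an algebraic integer, and let $\mathcal C_n,\mathcal D_n>0$ be real numbers such that $$\max\left(1,\frac{\Gamma(1-1/n)\,r!}{\Gamma(r+1-1/n)},\frac{n\Gamma(r+1+1/n)}{\Gamma(1/n)\,r!}\right)\frac{D_{n,r}}{N_{d,n,r}}<\mathcal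 C_n\left(\frac{\mathcal D_n}{\mathcal N_{d,n}}\right)^r$$ for all integers $r\ge 0$. Put $$E=\frac{|g|\mathcal N_{d,n}}{\mathcal D_n}\cdot\frac{4(|U|-|Z-U|)}{|Z-U|^2},\qquad Q=\frac{\mathcal D_n}{|g|\mathcal N_{d,n}}\cdot 2(|U|+|Z|),\qquad \kappa=\frac{\log Q}{\log E},$$ $$c=4h|\sqrt\tau|\left(|x-\beta_1|+|x-\beta_2|\right)\mathcal C_nQ\cdot\max\left(1,\,2h|\sqrt\tau|\,\bigl|1-W^{1/n}\bigr|\,|x-\beta_2|\,|\mathcal A-\beta_1|\,\mathcal C_nE\right)^{\kappa}.$$ **Theorem.** If $E>1$ and $\max(|1-W|,|1-1/W|)<1$, then the denominator of $\mathcal A$ is non-zero and $$\left|\mathcal A-\frac pq\right|>\frac{1}{c\,|q|^{\kappa+1}}$$ for all algebraic integers $p,q\in\mathbb K$ with $q\ne 0$. -/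

import Mathlib

open IntermediateField Polynomial

/-- A subfield of `ℂ` is an imaginary quadratic field if it has degree `2` over `ℚ` and is not
contained in the real numbers. -/
def IsImaginaryQuadratic (K : IntermediateField ℚ ℂ) : Prop :=
  Module.finrank ℚ K = 2 ∧ ∃ z ∈ K, z.im ≠ 0

/-- `z'` is the algebraic conjugate over `K` of the element `z` of the quadratic extension `K(β)`:
the image of `z` under the nontrivial `K`-automorphism of `K(β)`.  (In particular `z' = z` when
`z ∈ K`.)  This is used only when `[K(β) : K] = 2`. -/
def IsQuadraticConjugate (K : IntermediateField ℚ ℂ) (β z z' : ℂ) : Prop :=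
  ∃ σ : K⟮β⟯ ≃ₐ[K] K⟮β⟯, σ ≠ AlgEquiv.refl ∧ ∃ y : K⟮β⟯, (y : ℂ) = z ∧ ((σ y : K⟮β⟯) : ℂ) = z'

/-- The principal `n`-th root: if `w = s e^{iφ}` with `s ≥ 0` and `-π < φ ≤ π`, then this is
`s^{1/n} e^{iφ/n}`. -/
noncomputable def principalRoot (n : ℕ) (w : ℂ) : ℂ := w ^ ((1 : ℂ) / (n : ℂ))

/-- The hypergeometric polynomial `X_{n,r}(x) = ₂F₁(-r, -r - 1/n; 1 - 1/n; x)`. -/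
noncomputable def hypX (n r : ℕ) : ℚ[X] :=
  ∑ k ∈ Finset.range (r + 1),
    C (ordinaryHypergeometricCoefficient (-(r : ℚ)) (-(r : ℚ) - 1 / n) (1 - 1 / n) k) * X ^ k

/-- `D_{n,r}`: the smallest positive integer `D` such that `D * X_{n,r}` has integer
coefficients. -/
noncomputable def hypDenom (n r : ℕ) : ℕ :=
  sInf {D : ℕ | 0 < D ∧ ∀ k : ℕ, ∃ z : ℤ, (D : ℚ) * (hypX n r).coeff k = z}

/-- `N_{d,n,r}`: the greatest common divisor of the numerators of the coefficients of
`X_{n,r}(1 - d x)`. -/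
noncomputable def hypNumer (d n r : ℕ) : ℕ :=
  (Finset.range (r + 1)).gcd
    fun k => (((hypX n r).comp (1 - C (d : ℚ) * X)).coeff k).num.natAbs

/-- `𝒩_{d,n} = ∏_{p ∣ n} p ^ min (v_p(d), v_p(n) + 1/(p-1))`. -/
noncomputable def numerBase (d n : ℕ) : ℝ :=
  ∏ p ∈ n.primeFactors,
    (p : ℝ) ^ min (padicValNat p d : ℝ) ((padicValNat p n : ℝ) + 1 / ((p : ℝ) - 1))

/-- The admissibility condition on the positive real numbers `C = 𝒞_n`, `D = 𝒟_n`. -/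
def DenomBound (n d : ℕ) (C D : ℝ) : Prop :=
  ∀ r : ℕ,
    max 1 (max (Real.Gamma (1 - 1 / n) * r.factorial / Real.Gamma (r + 1 - 1 / n))
        (n * Real.Gamma (r + 1 + 1 / n) / (Real.Gamma (1 / n) * r.factorial)))
      * ((hypDenom n r : ℝ) / (hypNumer d n r : ℝ))
    < C * (D / numerBase d n) ^ r

/-!
The proof is an instance of the hypergeometric method of Thue and Siegel. Put `ν = 1 / n`,
`ω = W ^ ν` and `F(a, b) = b ^ r * X_{n,r}(a / b)`. The ratio `F(W, 1) / F(1, W)` is a Padé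
approximation to `ω`, and the Möbius transformation which carries `ω` to `𝒜`, applied to
`F(Z, U) / F(U, Z)`, gives approximations `p_r / q_r` to `𝒜`.

* *Error term.* `F(W, 1) - ω F(1, W)` is a multiple of `(W - 1) ^ (2 r + 1)` times the integral of
  `(l (1 - l)) ^ r * t ^ (ν - 1 - r)` over `0 ≤ l ≤ 1`, where `t = 1 + l (W - 1)`
  (`hypForm_sub_eq_integral`). The estimate `norm_hypForm_sub_le` compares this integral to the one
  for `r = 0`, which is `1 - ω` up to a factor. The loss of the triangle inequality is at most `5/4`
  (`integral_norm_le_norm_integral`), as the arguments of the points `t` lie in an interval of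
  length less than `π / 3`; for `r ≥ 1` it is outweighed by the average of `4 l (1 - l)` being at
  most `4 / 5` for the relevant weight (`integral_parabola_mul_le`).
* *Size.* The forms are compared coefficientwise to a multiple of `(2 (a + b)) ^ r`
  (`norm_hypForm_le`).
* *Arithmetic.* The factor `h_r / g ^ r * D_{n,r} / N_{d,n,r}` makes the values algebraic integers
  (`isIntegral_denom_div_numer_mul_hypForm`). Conjugation over `K` exchanges `U` and `-Z`, so that
  `p_r` and `q_r` are invariant up to a common sign, which is removed by a factor `√τ` if necessary
  (`exists_twist_of_quadratic`).
* *Independence.* `p_r q_{r+1} - p_{r+1} q_r` is a non-zero multiple of `(W - 1) ^ (2 r + 1)`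
  (`hypForm_det_ne_zero`).

Since non-zero integers of `K` have absolute value at least `1`, these facts give the lower bound
(`lower_bound_of_approximations`). They also show that the denominator of `𝒜` does not vanish:
otherwise the `q_r` would tend to `0`, hence vanish for all large `r`, contradicting the independence
(`not_geometric_decay`).
-/

/-! ### The coefficients of the hypergeometric polynomials -/

/-- The partial fraction expansion of `r! / (x (x + 1) ⋯ (x + r))`. -/
theorem sum_neg_one_pow_choose_div {F : Type*} [Field F] [CharZero F] (r : ℕ) :
    ∀ x : F, (∀ i : ℕ, x + i ≠ 0) →
      ∑ i ∈ Finset.range (r + 1), (-1) ^ i * (r.choose i : F) / (x + i) =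
        r.factorial / ∏ i ∈ Finset.range (r + 1), (x + i) := by
  induction r with
  | zero => intro x hx; simp
  | succ r ih =>
    intro x hx
    have hx' : ∀ i : ℕ, (x + 1) + i ≠ 0 := fun i => by
      have := hx (i + 1); push_cast at this; rwa [add_assoc, add_comm (1 : F)]
    have h1 := ih x hx
    have h2 := ih (x + 1) hx'
    have key : ∑ i ∈ Finset.range (r + 1 + 1), (-1) ^ i * ((r + 1).choose i : F) / (x + i) =
        ∑ i ∈ Finset.range (r + 1), (-1) ^ i * (r.choose i : F) / (x + i) -
        ∑ i ∈ Finset.range (r + 1), (-1) ^ i * (r.choose i : F) / (x + 1 + i) := by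
      rw [Finset.sum_range_succ']
      have h3 : ∑ i ∈ Finset.range (r + 1), (-1) ^ i * (r.choose i : F) / (x + i) =
          ∑ i ∈ Finset.range (r + 1), (-1) ^ (i + 1) * (r.choose (i + 1) : F) / (x + (i + 1 : ℕ))
            + 1 / x := by
        have := Finset.sum_range_succ' (fun i : ℕ => (-1) ^ i * (r.choose i : F) / (x + i)) (r + 1)
        rw [Finset.sum_range_succ] at this
        simpa using this
      rw [h3, add_sub_right_comm, ← Finset.sum_sub_distrib]
      congr 1
      · refine Finset.sum_congr rfl fun i _ => ?_
        rw [Nat.choose_succ_succ]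
        push_cast
        rw [show x + 1 + (i : F) = x + (i + 1) by ring]
        ring
      · simp
    rw [key, h1, h2]
    have hP : ∏ i ∈ Finset.range (r + 1 + 1), (x + i) ≠ 0 :=
      Finset.prod_ne_zero_iff.2 fun i _ => hx i
    have e1 := Finset.prod_range_succ (fun i : ℕ => x + (i : F)) (r + 1)
    have e2 := Finset.prod_range_succ' (fun i : ℕ => x + (i : F)) (r + 1)
    have e3 : ∏ i ∈ Finset.range (r + 1), (x + (i + 1 : ℕ)) =
        ∏ i ∈ Finset.range (r + 1), (x + 1 + i) :=
      Finset.prod_congr rfl fun i _ => by push_cast; ring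
    rw [e3] at e2
    have hA : ∏ i ∈ Finset.range (r + 1), (x + i) ≠ 0 :=
      Finset.prod_ne_zero_iff.2 fun i _ => hx i
    have hB : ∏ i ∈ Finset.range (r + 1), (x + 1 + i) ≠ 0 :=
      Finset.prod_ne_zero_iff.2 fun i _ => hx' i
    rw [div_sub_div _ _ hA hB, div_eq_div_iff (mul_ne_zero hA hB) hP, Nat.factorial_succ]
    have e4 := e1.symm.trans e2
    push_cast at e4 ⊢
    set a := ∏ i ∈ Finset.range (r + 1), (x + (i : F))
    set b := ∏ i ∈ Finset.range (r + 1), (x + 1 + (i : F))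
    rw [e1]
    push_cast
    linear_combination -(r.factorial : F) * a * e4

/-- The coefficient of `x ^ k` in `₂F₁(-r, -r - ν; 1 - ν; x)`, for a real parameter `ν`. -/
noncomputable def hypCoeff (ν : ℝ) (r k : ℕ) : ℝ :=
  r.choose k * ∏ m ∈ Finset.range k, (r + ν - m) / (m + 1 - ν)

/-- The binary form `b ^ r * ₂F₁(-r, -r - ν; 1 - ν; a / b)`. -/
noncomputable def hypForm (ν : ℝ) (r : ℕ) (a b : ℂ) : ℂ :=
  ∑ k ∈ Finset.range (r + 1), (hypCoeff ν r k : ℂ) * a ^ k * b ^ (r - k)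

theorem hypForm_mul_mul (ν : ℝ) (r : ℕ) (u a b : ℂ) :
    hypForm ν r (u * a) (u * b) = u ^ r * hypForm ν r a b := by
  unfold hypForm
  rw [Finset.mul_sum]
  refine Finset.sum_congr rfl fun k hk => ?_
  obtain ⟨j, rfl⟩ := Nat.exists_eq_add_of_le (Finset.mem_range_succ_iff.1 hk)
  rw [Nat.add_sub_cancel_left, mul_pow, mul_pow, pow_add]
  ring

theorem hypForm_swap_sum (ν : ℝ) (r : ℕ) (a b : ℂ) :
    hypForm ν r a b =
      ∑ k ∈ Finset.range (r + 1), (hypCoeff ν r (r - k) : ℂ) * a ^ (r - k) * b ^ k := by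
  unfold hypForm
  rw [← Finset.sum_range_reflect]
  refine Finset.sum_congr rfl fun k hk => ?_
  have := Finset.mem_range_succ_iff.1 hk
  rw [show r + 1 - 1 - k = r - k by omega, show r - (r - k) = k by omega]

/-- The coefficients of the hypergeometric polynomial in the form in which they occur as residues of a
partial fraction expansion. -/
theorem hypCoeff_mul_prod {ν : ℝ} (hν1 : ν < 1) (r j : ℕ) :
    hypCoeff ν r j * ∏ i ∈ Finset.range (r + 1), (ν - j + i) =
      (-1) ^ j * r.choose j * ∏ i ∈ Finset.range (r + 1), (ν + i) := by
  have key : ∀ j : ℕ, (∏ m ∈ Finset.range j, (r + ν - m) / (m + 1 - ν)) *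
      ∏ i ∈ Finset.range (r + 1), (ν - j + i) =
      (-1) ^ j * ∏ i ∈ Finset.range (r + 1), (ν + i) := by
    intro j
    induction j with
    | zero => simp
    | succ j ih =>
      have e1 := Finset.prod_range_succ (fun i : ℕ => ν - (j + 1 : ℕ) + (i : ℝ)) (r + 1)
      have e2 := Finset.prod_range_succ' (fun i : ℕ => ν - (j + 1 : ℕ) + (i : ℝ)) (r + 1)
      have e3 : ∏ i ∈ Finset.range (r + 1), (ν - (j + 1 : ℕ) + (i + 1 : ℕ)) =
          ∏ i ∈ Finset.range (r + 1), (ν - j + i) :=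
        Finset.prod_congr rfl fun i _ => by push_cast; ring
      rw [e3] at e2
      have e4 := e1.symm.trans e2
      have hj : (j : ℝ) + 1 - ν ≠ 0 := by
        have : (0 : ℝ) ≤ j := j.cast_nonneg
        linarith
      rw [Finset.prod_range_succ, pow_succ]
      push_cast at e4 ⊢
      field_simp
      linear_combination -(j + 1 - ν) * ih +
        (∏ m ∈ Finset.range j, (r + ν - m) / (m + 1 - ν)) * e4
  unfold hypCoeff
  rw [mul_assoc, key]
  ring

theorem prod_ratio_nonneg {ν : ℝ} (hν : 0 < ν) (hν1 : ν < 1) {r k : ℕ} (hk : k ≤ r) :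
    0 ≤ ∏ m ∈ Finset.range k, (r + ν - m) / (m + 1 - ν) := by
  refine Finset.prod_nonneg fun m hm => div_nonneg ?_ ?_
  · have : (m : ℝ) ≤ r := by exact_mod_cast (Finset.mem_range.1 hm).le.trans hk
    linarith
  · have : (0 : ℝ) ≤ m := m.cast_nonneg
    linarith

theorem hypCoeff_nonneg {ν : ℝ} (hν : 0 < ν) (hν1 : ν < 1) {r k : ℕ} (hk : k ≤ r) :
    0 ≤ hypCoeff ν r k :=
  mul_nonneg (Nat.cast_nonneg _) (prod_ratio_nonneg hν hν1 hk)

theorem prod_ratio_succ_succ {ν : ℝ} (r k : ℕ) :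
    ∏ m ∈ Finset.range (k + 1), (((r + 1 : ℕ) : ℝ) + ν - m) / (m + 1 - ν) =
      (∏ m ∈ Finset.range k, (r + ν - m) / (m + 1 - ν)) * ((r + 1 + ν) / (k + 1 - ν)) := by
  rw [Finset.prod_div_distrib, Finset.prod_range_succ', Finset.prod_range_succ,
    Finset.prod_div_distrib]
  have : ∏ m ∈ Finset.range k, (((r + 1 : ℕ) : ℝ) + ν - (m + 1 : ℕ)) =
      ∏ m ∈ Finset.range k, ((r : ℝ) + ν - m) :=
    Finset.prod_congr rfl fun m _ => by push_cast; ring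
  rw [this]
  push_cast
  rw [div_mul_div_comm]
  ring_nf

theorem prod_ratio_succ_left {ν : ℝ} (hν1 : ν < 1) (r k : ℕ) :
    (∏ m ∈ Finset.range k, (((r + 1 : ℕ) : ℝ) + ν - m) / (m + 1 - ν)) * (r + 1 - k + ν) =
      (∏ m ∈ Finset.range k, (r + ν - m) / (m + 1 - ν)) * (r + 1 + ν) := by
  have h := prod_ratio_succ_succ (ν := ν) r k
  rw [Finset.prod_range_succ] at h
  have hk : (k : ℝ) + 1 - ν ≠ 0 := by
    have : (0 : ℝ) ≤ k := k.cast_nonneg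
    linarith
  push_cast at h ⊢
  field_simp at h
  linear_combination h

/-- The analogue of `r.choose k ≤ 2 ^ r` for the parameter `ν`. -/
theorem prod_ratio_mul_prod_le {ν : ℝ} (hν : 0 < ν) (hν1 : ν < 1 / 2) (r : ℕ) :
    ∀ k ≤ r, (∏ m ∈ Finset.range k, (r + ν - m) / (m + 1 - ν)) *
      ∏ m ∈ Finset.range r, ((m : ℝ) + 1 - ν) ≤ r.factorial * 2 ^ r := by
  induction r with
  | zero => intro k hk; obtain rfl : k = 0 := by omega
            simp
  | succ r ih =>
    have hr : (0 : ℝ) ≤ r := r.cast_nonneg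
    have he : 0 ≤ ∏ m ∈ Finset.range r, ((m : ℝ) + 1 - ν) :=
      Finset.prod_nonneg fun m _ => by
        have : (0 : ℝ) ≤ m := m.cast_nonneg
        linarith
    have aux : ∀ y s : ℝ, 0 < s → ((r : ℝ) + 1) / 2 ≤ s → y ≤ r.factorial * 2 ^ r →
        y * ((r + 1 + ν) / s) * (r + 1 - ν) ≤ ((r + 1).factorial : ℝ) * 2 ^ (r + 1) := by
      intro y s hs hs2 hy
      have h1 : (r + 1 + ν) / s * (r + 1 - ν) ≤ 2 * (r + 1) := by
        rw [div_mul_eq_mul_div, div_le_iff₀ hs]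
        nlinarith
      have h2 : 0 ≤ (r + 1 + ν) / s * (r + 1 - ν) :=
        mul_nonneg (div_nonneg (by linarith) hs.le) (by linarith)
      have h3 : (0 : ℝ) ≤ r.factorial * 2 ^ r := by positivity
      calc y * ((r + 1 + ν) / s) * (r + 1 - ν) = y * ((r + 1 + ν) / s * (r + 1 - ν)) := by ring
        _ ≤ (r.factorial * 2 ^ r) * (2 * (r + 1)) :=
            (mul_le_mul_of_nonneg_right hy h2).trans (mul_le_mul_of_nonneg_left h1 h3)
        _ = _ := by rw [Nat.factorial_succ]; push_cast; ring
    intro k hk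
    rw [Finset.prod_range_succ (fun m : ℕ => (m : ℝ) + 1 - ν)]
    -- `k - ν` and `r + 1 - k + ν` add up to `r + 1`, so one of them is at least half of it.
    rcases le_total (((r : ℝ) + 1) / 2) (k - ν) with hc | hc
    · obtain _ | k := k
      · push_cast at hc; linarith
      · have hpos : (0 : ℝ) < k + 1 - ν := by
          have : (0 : ℝ) ≤ k := k.cast_nonneg
          linarith
        push_cast at hc
        have := aux _ (k + 1 - ν) hpos hc (ih k (by omega))
        rw [prod_ratio_succ_succ]
        calc _ = _ := by ring
          _ ≤ _ := this
    · have hs : ((r : ℝ) + 1) / 2 ≤ r + 1 - k + ν := by linarith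
      have hs0 : (0 : ℝ) < r + 1 - k + ν := by linarith
      have hkr : k ≤ r := by
        by_contra hcon
        obtain rfl : k = r + 1 := by omega
        push_cast at hc
        linarith
      have := aux _ _ hs0 hs (ih k hkr)
      have h4 := prod_ratio_succ_left (ν := ν) (by linarith) r k
      rw [← eq_div_iff hs0.ne'] at h4
      rw [h4]
      calc _ = _ := by ring
        _ ≤ _ := this

theorem prod_add_one_sub_pos {ν : ℝ} (hν1 : ν < 1) (r : ℕ) :
    0 < ∏ m ∈ Finset.range r, ((m : ℝ) + 1 - ν) :=
  Finset.prod_pos fun m _ => by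
    have : (0 : ℝ) ≤ m := m.cast_nonneg
    linarith

/-- The size of the approximating forms. -/
theorem norm_hypForm_le {ν : ℝ} (hν : 0 < ν) (hν1 : ν < 1 / 2) (r : ℕ) (a b : ℂ) :
    ‖hypForm ν r a b‖ ≤ r.factorial / (∏ m ∈ Finset.range r, ((m : ℝ) + 1 - ν)) *
      (2 * (‖a‖ + ‖b‖)) ^ r := by
  have he := prod_add_one_sub_pos (show ν < 1 by linarith) r
  rw [mul_pow, add_pow, Finset.mul_sum, Finset.mul_sum]
  refine (norm_sum_le _ _).trans (Finset.sum_le_sum fun k hk => ?_)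
  have hk' := Finset.mem_range_succ_iff.1 hk
  have hnn := hypCoeff_nonneg hν (show ν < 1 by linarith) hk'
  rw [norm_mul, norm_mul, norm_pow, norm_pow, Complex.norm_real, Real.norm_of_nonneg hnn]
  have h1 : hypCoeff ν r k ≤ r.factorial / (∏ m ∈ Finset.range r, ((m : ℝ) + 1 - ν)) *
      (2 ^ r * r.choose k) := by
    have := prod_ratio_mul_prod_le hν hν1 r k hk'
    unfold hypCoeff
    rw [← le_div_iff₀ he] at this
    calc _ ≤ (r.choose k : ℝ) * _ := mul_le_mul_of_nonneg_left this (Nat.cast_nonneg _)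
      _ = _ := by ring
  calc hypCoeff ν r k * ‖a‖ ^ k * ‖b‖ ^ (r - k)
      = hypCoeff ν r k * (‖a‖ ^ k * ‖b‖ ^ (r - k)) := by ring
    _ ≤ _ := mul_le_mul_of_nonneg_right h1 (by positivity)
    _ = _ := by ring

theorem hypCoeff_self_lt {ν : ℝ} (hν : 0 < ν) (hν1 : ν < 1) (r : ℕ) :
    hypCoeff ν r r < hypCoeff ν (r + 1) (r + 1) := by
  unfold hypCoeff
  rw [Nat.choose_self, Nat.choose_self, prod_ratio_succ_succ, Nat.cast_one, one_mul, one_mul]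
  have hr : (0 : ℝ) ≤ r := r.cast_nonneg
  refine lt_mul_of_one_lt_right ?_ ?_
  · refine Finset.prod_pos fun m hm => div_pos ?_ ?_
    · have : (m : ℝ) ≤ r := by exact_mod_cast (Finset.mem_range.1 hm).le
      linarith
    · have : (0 : ℝ) ≤ m := m.cast_nonneg
      linarith
  · rw [one_lt_div (by linarith)]
    linarith

/-! ### The remainder as an integral -/

/-- `hypCoeff_mul_prod` combined with the partial fraction expansion. -/
theorem hypCoeff_mul_factorial {ν : ℝ} (hν : 0 < ν) (hν1 : ν < 1) (r j : ℕ) :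
    (∏ i ∈ Finset.range (r + 1), (ν + i)) * ((-1) ^ j * r.choose j *
      ∑ i ∈ Finset.range (r + 1), (-1) ^ i * (r.choose i : ℝ) / (ν - j + i)) =
      r.factorial * hypCoeff ν r j := by
  have hne : ∀ i : ℕ, ν - j + i ≠ 0 := fun i h0 => by
    have h1 : ν = ((j - i : ℤ) : ℝ) := by push_cast; linarith
    have h2 : (0 : ℤ) < j - i := by exact_mod_cast h1 ▸ hν
    have h3 : (j - i : ℤ) < 1 := by exact_mod_cast h1 ▸ hν1
    omega
  rw [sum_neg_one_pow_choose_div r _ hne]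
  have hP : ∏ i ∈ Finset.range (r + 1), (ν - j + i) ≠ 0 :=
    Finset.prod_ne_zero_iff.2 fun i _ => hne i
  have := hypCoeff_mul_prod hν1 r j
  field_simp
  linear_combination -this

theorem seg_re_pos {w : ℂ} (hw : 0 < w.re) {l : ℝ} (hl : l ∈ Set.Icc (0 : ℝ) 1) :
    0 < (1 + l * (w - 1) : ℂ).re := by
  simp only [Complex.add_re, Complex.one_re, Complex.re_ofReal_mul, Complex.sub_re]
  nlinarith [hl.1, hl.2, mul_nonneg hl.1 hw.le, mul_nonneg (sub_nonneg.2 hl.2) hw.le]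

theorem continuousOn_seg_cpow {w : ℂ} (hw : 0 < w.re) (e : ℂ) :
    ContinuousOn (fun l : ℝ => (1 + l * (w - 1) : ℂ) ^ e) (Set.Icc 0 1) := by
  refine ContinuousOn.cpow (by fun_prop) continuousOn_const fun l hl => ?_
  exact Or.inl (seg_re_pos hw hl)

/-- The integral of `((1 - t) * (t - w)) ^ r * t ^ (ν - r - 1)` along the segment from `1` to `w`,
evaluated through an antiderivative, is a multiple of the remainder of the
Padé approximation to `w ^ ν`. -/
theorem hypForm_sub_eq_integral {ν : ℝ} (hν : 0 < ν) (hν1 : ν < 1) (r : ℕ) {w : ℂ}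
    (hw : 0 < w.re) :
    (∏ i ∈ Finset.range (r + 1), (ν + i) : ℝ) * ((w - 1) ^ (2 * r + 1) *
      ∫ l in (0 : ℝ)..1, (l * (1 - l) : ℂ) ^ r * (1 + l * (w - 1) : ℂ) ^ ((ν - 1 - r : ℝ) : ℂ)) =
      r.factorial * (w ^ (ν : ℂ) * hypForm ν r 1 w - hypForm ν r w 1) := by
  have hne : ∀ i j : ℕ, (ν : ℂ) + i - j ≠ 0 := fun i j h0 => by
    have h0' : ν + i - j = 0 := by exact_mod_cast h0
    have h1 : ν = ((j - i : ℤ) : ℝ) := by push_cast; linarith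
    have h2 : (0 : ℤ) < j - i := by exact_mod_cast h1 ▸ hν
    have h3 : (j - i : ℤ) < 1 := by exact_mod_cast h1 ▸ hν1
    omega
  have hw0 : w ≠ 0 := fun h => by simp [h] at hw
  -- the antiderivative of `((1 - t) * (t - w)) ^ r * t ^ (ν - r - 1)`, expanded in powers of `t`
  set Φ : ℂ → ℂ := fun t => ∑ i ∈ Finset.range (r + 1), ∑ j ∈ Finset.range (r + 1),
    ((-1) ^ i * r.choose i) * ((-1) ^ j * r.choose j * w ^ j) *
      (t ^ ((ν : ℂ) + i - j) / ((ν : ℂ) + i - j)) with hΦ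
  have hderiv : ∀ l ∈ Set.uIcc (0 : ℝ) 1,
      HasDerivAt (fun l : ℝ => Φ (1 + l * (w - 1)))
        ((w - 1) ^ (2 * r + 1) *
          ((l * (1 - l) : ℂ) ^ r * (1 + l * (w - 1) : ℂ) ^ ((ν - 1 - r : ℝ) : ℂ))) l := by
    intro l hl
    rw [Set.uIcc_of_le zero_le_one] at hl
    have hre := seg_re_pos hw hl
    set t : ℂ := 1 + l * (w - 1) with ht
    have ht0 : t ≠ 0 := fun h => by simp [h] at hre
    have hseg : HasDerivAt (fun l : ℝ => (1 + l * (w - 1) : ℂ)) (w - 1) l := by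
      have := ((Complex.ofRealCLM.hasDerivAt (x := l)).mul_const (w - 1)).const_add 1
      simpa using this
    have hd : HasDerivAt Φ (∑ i ∈ Finset.range (r + 1), ∑ j ∈ Finset.range (r + 1),
        ((-1) ^ i * r.choose i) * ((-1) ^ j * r.choose j * w ^ j) *
          t ^ ((ν : ℂ) + i - j - 1)) t := by
      refine HasDerivAt.fun_sum fun i _ => HasDerivAt.fun_sum fun j _ => ?_
      refine HasDerivAt.const_mul _ ?_
      have := ((hasDerivAt_id t).cpow_const (c := (ν : ℂ) + i - j) (Or.inl hre)).div_const
        ((ν : ℂ) + i - j)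
      convert! this using 1
      simp only [id]
      field_simp [hne i j]
    have hcomp := hd.comp l hseg
    convert! hcomp using 1
    have e1 : ∀ i ∈ Finset.range (r + 1), ∀ j ∈ Finset.range (r + 1),
        ((-1) ^ i * r.choose i) * ((-1) ^ j * r.choose j * w ^ j) * t ^ ((ν : ℂ) + i - j - 1) =
        t ^ ((ν - 1 - r : ℝ) : ℂ) * (((-t) ^ i * 1 ^ (r - i) * (r.choose i : ℂ)) *
          ((-w) ^ j * t ^ (r - j) * (r.choose j : ℂ))) := by
      intro i _ j hj
      have hj' := Finset.mem_range_succ_iff.1 hj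
      have : (ν : ℂ) + i - j - 1 = ((ν - 1 - r : ℝ) : ℂ) + ((i + (r - j) : ℕ) : ℂ) := by
        push_cast [Nat.cast_sub hj']; ring
      rw [this, Complex.cpow_add _ _ ht0, Complex.cpow_natCast, pow_add, neg_pow t, neg_pow w]
      ring
    rw [Finset.sum_congr rfl fun i hi => Finset.sum_congr rfl fun j hj => e1 i hi j hj]
    simp only [← Finset.mul_sum]
    rw [← Finset.sum_mul, ← add_pow, ← add_pow,
      show (-t + 1 : ℂ) = -(l * (w - 1)) by rw [ht]; ring,
      show (-w + t : ℂ) = -((1 - l) * (w - 1)) by rw [ht]; ring]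
    have : ((-(l * (w - 1))) ^ r * (-((1 - l) * (w - 1))) ^ r : ℂ) =
        (w - 1) ^ (2 * r) * (l * (1 - l)) ^ r := by
      rw [pow_mul, ← mul_pow, ← mul_pow]; ring_nf
    rw [this]
    ring
  have hint := intervalIntegral.integral_eq_sub_of_hasDerivAt hderiv (by
    refine ContinuousOn.intervalIntegrable ?_
    rw [Set.uIcc_of_le zero_le_one]
    exact continuousOn_const.mul
      ((by fun_prop : ContinuousOn (fun l : ℝ => (l * (1 - l) : ℂ) ^ r) _).mul
        (continuousOn_seg_cpow hw _)))
  rw [intervalIntegral.integral_const_mul] at hint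
  rw [hint, mul_sub _ (Φ _), mul_sub (r.factorial : ℂ)]
  have hcoef : ∀ j : ℕ, ((∏ i ∈ Finset.range (r + 1), (ν + i) : ℝ) : ℂ) *
      ((-1) ^ j * r.choose j *
      ∑ i ∈ Finset.range (r + 1), (-1) ^ i * (r.choose i : ℂ) / (ν - j + i)) =
      r.factorial * (hypCoeff ν r j : ℂ) := fun j => by
    exact_mod_cast congrArg (fun y : ℝ => (y : ℂ)) (hypCoeff_mul_factorial hν hν1 r j)
  congr 1
  · -- upper end point
    rw [hypForm_swap_sum]
    simp only [hΦ, Complex.ofReal_one, one_mul, add_sub_cancel, one_pow, mul_one]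
    rw [Finset.mul_sum, Finset.mul_sum, Finset.mul_sum]
    refine Finset.sum_congr rfl fun i hi => ?_
    have hi' := Finset.mem_range_succ_iff.1 hi
    have h1 := hcoef (r - i)
    rw [← Finset.sum_range_reflect (fun k : ℕ =>
      (-1) ^ k * (r.choose k : ℂ) / ((ν : ℂ) - (r - i : ℕ) + k))] at h1
    rw [mul_comm (hypCoeff ν r (r - i) : ℂ), mul_left_comm, mul_left_comm (r.factorial : ℂ), ← h1,
      Finset.mul_sum, Finset.mul_sum, Finset.mul_sum, Finset.mul_sum, Finset.mul_sum]
    refine Finset.sum_congr rfl fun j hj => ?_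
    have hj' := Finset.mem_range_succ_iff.1 hj
    rw [show r + 1 - 1 - j = r - j by omega, Nat.choose_symm hi', Nat.choose_symm hj',
      Nat.cast_sub hi', Nat.cast_sub hj', Complex.cpow_sub _ _ hw0, Complex.cpow_add _ _ hw0,
      Complex.cpow_natCast, Complex.cpow_natCast,
      show (ν : ℂ) - (r - i) + (r - j) = ν + i - j by ring]
    have s1 : (-1 : ℂ) ^ (r - i) * (-1) ^ (r - j) = (-1) ^ i * (-1) ^ j := by
      rw [← pow_add, ← pow_add]
      have : (-1 : ℂ) ^ (r - i + (r - j)) * (-1) ^ (i + j) = 1 := by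
        rw [← pow_add, show r - i + (r - j) + (i + j) = 2 * r by omega, pow_mul]; simp
      have h2 : (-1 : ℂ) ^ (i + j) * (-1) ^ (i + j) = 1 := by
        rw [← pow_add, ← two_mul, pow_mul]; simp
      calc _ = (-1 : ℂ) ^ (r - i + (r - j)) * ((-1) ^ (i + j) * (-1) ^ (i + j)) := by
            rw [h2, mul_one]
        _ = _ := by rw [← mul_assoc, this, one_mul]
    have hwj : w ^ j ≠ 0 := pow_ne_zero _ hw0
    have hn := hne i j
    field_simp
    linear_combination -(((∏ i ∈ Finset.range (r + 1), (ν + i) : ℝ) : ℂ) * (r.choose i : ℂ) *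
      (r.choose j) * w ^ (ν : ℂ)) * s1
  · -- lower end point
    unfold hypForm
    simp only [hΦ, Complex.ofReal_zero, zero_mul, add_zero, Complex.one_cpow, one_pow, mul_one]
    rw [Finset.sum_comm, Finset.mul_sum, Finset.mul_sum]
    refine Finset.sum_congr rfl fun j _ => ?_
    rw [← mul_assoc, ← hcoef j, Finset.mul_sum, Finset.mul_sum, Finset.mul_sum, Finset.sum_mul]
    refine Finset.sum_congr rfl fun i _ => ?_
    rw [show (ν : ℂ) + i - j = ν - j + i by ring]
    ring

/-! ### Estimates for the remainder -/

/-- If `cos (arg s) ≥ k`, then `cos (e * arg s) ≥ k` for all exponents `e` in `[-1, 0]`. -/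
theorem cpow_re_ge {s : ℂ} (hs : 0 < s.re) {e : ℝ} (he : -1 ≤ e) (he0 : e ≤ 0) {k : ℝ}
    (hk : k * ‖s‖ ≤ s.re) : k * ‖s‖ ^ e ≤ (s ^ (e : ℂ)).re := by
  have hs0 : s ≠ 0 := fun h => by simp [h] at hs
  have hn : 0 < ‖s‖ := norm_pos_iff.2 hs0
  rw [Complex.cpow_ofReal_re, mul_comm]
  refine mul_le_mul_of_nonneg_left ?_ (Real.rpow_nonneg hn.le _)
  have h1 : k ≤ Real.cos s.arg := by
    rw [Complex.cos_arg hs0, le_div_iff₀ hn]; exact hk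
  refine h1.trans ?_
  rw [← Real.cos_abs s.arg, ← Real.cos_abs (s.arg * e)]
  refine Real.cos_le_cos_of_nonneg_of_le_pi (abs_nonneg _) (Complex.abs_arg_le_pi s) ?_
  rw [abs_mul]
  exact mul_le_of_le_one_right (abs_nonneg _) (abs_le.2 ⟨he, by linarith⟩)

theorem mul_cpow_of_re_pos {s v : ℂ} (hs : 0 < s.re) (hv : 0 < v.re) (e : ℂ) :
    (s * v) ^ e = s ^ e * v ^ e := by
  have hs0 : s ≠ 0 := fun h => by simp [h] at hs
  have hv0 : v ≠ 0 := fun h => by simp [h] at hv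
  have h1 := abs_lt.1 (Complex.abs_arg_lt_pi_div_two_iff.2 (Or.inl hs))
  have h2 := abs_lt.1 (Complex.abs_arg_lt_pi_div_two_iff.2 (Or.inl hv))
  rw [Complex.cpow_def_of_ne_zero (mul_ne_zero hs0 hv0), Complex.cpow_def_of_ne_zero hs0,
    Complex.cpow_def_of_ne_zero hv0, Complex.log_mul hs0 hv0 ⟨by linarith [h1.1, h2.1],
      by linarith [h1.2, h2.2]⟩, add_mul, Complex.exp_add]

/-- If the argument of `w` is at most `π / 3`, then that of `√w` is at most `π / 6`, and
`cos (π / 6) ≥ 4 / 5`. -/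
theorem exists_sqrt_re_ge {w : ℂ} (hw : ‖w‖ ≤ 2 * w.re) (hre : 0 < w.re) :
    ∃ v : ℂ, v ^ 2 = w ∧ 0 < v.re ∧ 4 / 5 * ‖v‖ ≤ v.re := by
  obtain ⟨u, hu⟩ : ∃ u : ℂ, u ^ 2 = w := IsAlgClosed.exists_pow_nat_eq w two_pos
  obtain ⟨v, hv, hv0⟩ : ∃ v : ℂ, v ^ 2 = w ∧ 0 ≤ v.re := by
    rcases le_total 0 u.re with h | h
    · exact ⟨u, hu, h⟩
    · exact ⟨-u, by rw [neg_sq, hu], by simpa using h⟩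
  have h1 : ‖w‖ = v.re ^ 2 + v.im ^ 2 := by
    rw [← hv, norm_pow, Complex.sq_norm, Complex.normSq_apply]; ring
  have h2 : w.re = v.re ^ 2 - v.im ^ 2 := by rw [← hv, sq, Complex.mul_re]; ring
  have h3 : ‖v‖ ^ 2 = v.re ^ 2 + v.im ^ 2 := by
    rw [Complex.sq_norm, Complex.normSq_apply]; ring
  refine ⟨v, hv, lt_of_le_of_ne hv0 fun h => ?_, ?_⟩
  · rw [← h] at h2; nlinarith [sq_nonneg v.im]
  · refine abs_le_of_sq_le_sq' ?_ hv0 |>.2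
    nlinarith [sq_nonneg v.im]

/-- The triangle inequality for the integral of `t ^ e` over the segment from `1` to `w` loses a
factor of at most `5 / 4`: after division by a square root `v` of `w`, the segment joins `1 / v` to
`v`, and its points have arguments at most `arg v` in absolute value. -/
theorem integral_norm_le_norm_integral {w : ℂ} (hw : ‖w‖ ≤ 2 * w.re) (hre : 0 < w.re) {e : ℝ}
    (he : -1 ≤ e) (he0 : e ≤ 0) :
    4 / 5 * ∫ l in (0 : ℝ)..1, ‖(1 + l * (w - 1) : ℂ)‖ ^ e ≤
      ‖∫ l in (0 : ℝ)..1, (1 + l * (w - 1) : ℂ) ^ (e : ℂ)‖ := by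
  obtain ⟨v, rfl, hv, hv45⟩ := exists_sqrt_re_ge hw hre
  have hv0 : v ≠ 0 := fun h => by simp [h] at hv
  have hvn : 0 < ‖v‖ := norm_pos_iff.2 hv0
  set s : ℝ → ℂ := fun l => (1 - l) / v + l * v with hs
  have hst : ∀ l : ℝ, s l * v = 1 + l * (v ^ 2 - 1) := fun l => by
    simp only [hs]; field_simp; ring
  have hvinv : (v⁻¹).re = v.re / ‖v‖ ^ 2 := by
    rw [Complex.inv_re, Complex.sq_norm]
  have hsre : ∀ l : ℝ, (s l).re = v.re * ((1 - l) / ‖v‖ ^ 2 + l) := fun l => by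
    have : s l = ((1 - l : ℝ) : ℂ) * v⁻¹ + l * v := by simp [hs, div_eq_mul_inv]
    rw [this, Complex.add_re, Complex.re_ofReal_mul, Complex.re_ofReal_mul, hvinv]
    ring
  have hspos : ∀ l ∈ Set.Icc (0 : ℝ) 1, 0 < (s l).re := fun l hl => by
    rw [hsre]
    refine mul_pos hv ?_
    rcases hl.1.eq_or_lt with h | h
    · rw [← h]; positivity
    · have : 0 ≤ (1 - l) / ‖v‖ ^ 2 := div_nonneg (sub_nonneg.2 hl.2) (by positivity)
      linarith
  have hs45 : ∀ l ∈ Set.Icc (0 : ℝ) 1, 4 / 5 * ‖s l‖ ≤ (s l).re := fun l hl => by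
    have h1 : ‖s l‖ ≤ ‖v‖ * ((1 - l) / ‖v‖ ^ 2 + l) := by
      refine (norm_add_le _ _).trans ?_
      rw [norm_div, norm_mul, Complex.norm_real, Real.norm_of_nonneg hl.1,
        show (1 - l : ℂ) = ((1 - l : ℝ) : ℂ) by push_cast; ring, Complex.norm_real,
        Real.norm_of_nonneg (sub_nonneg.2 hl.2)]
      refine le_of_eq ?_
      field_simp
    rw [hsre]
    have h2 : 0 ≤ (1 - l) / ‖v‖ ^ 2 + l :=
      add_nonneg (div_nonneg (sub_nonneg.2 hl.2) (by positivity)) hl.1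
    nlinarith [mul_le_mul_of_nonneg_right hv45 h2]
  have hcont : ContinuousOn (fun l : ℝ => s l ^ (e : ℂ)) (Set.Icc 0 1) :=
    ContinuousOn.cpow (by simp only [hs]; fun_prop) continuousOn_const
      fun l hl => Or.inl (hspos l hl)
  have hcont' : ContinuousOn (fun l : ℝ => ‖s l‖ ^ e) (Set.Icc 0 1) :=
    (hcont.norm).congr fun l _ => (Complex.norm_cpow_real _ _).symm
  have hI : IntervalIntegrable (fun l : ℝ => s l ^ (e : ℂ)) MeasureTheory.volume 0 1 :=
    ContinuousOn.intervalIntegrable (by rwa [Set.uIcc_of_le zero_le_one])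
  have hI' : IntervalIntegrable (fun l : ℝ => ‖s l‖ ^ e) MeasureTheory.volume 0 1 :=
    ContinuousOn.intervalIntegrable (by rwa [Set.uIcc_of_le zero_le_one])
  have hre_int : (∫ l in (0 : ℝ)..1, s l ^ (e : ℂ)).re =
      ∫ l in (0 : ℝ)..1, (s l ^ (e : ℂ)).re :=
    (Complex.reCLM.intervalIntegral_comp_comm hI).symm
  have hle : 4 / 5 * ∫ l in (0 : ℝ)..1, ‖s l‖ ^ e ≤ ‖∫ l in (0 : ℝ)..1, s l ^ (e : ℂ)‖ := by
    refine le_trans ?_ (Complex.re_le_norm _)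
    rw [hre_int, ← intervalIntegral.integral_const_mul]
    refine intervalIntegral.integral_mono_on zero_le_one (hI'.const_mul _) ?_ fun l hl =>
      cpow_re_ge (hspos l hl) he he0 (hs45 l hl)
    exact ContinuousOn.intervalIntegrable (by
      rw [Set.uIcc_of_le zero_le_one]; exact Complex.continuous_re.comp_continuousOn hcont)
  have e1 : ∫ l in (0 : ℝ)..1, (1 + l * (v ^ 2 - 1) : ℂ) ^ (e : ℂ) =
      (∫ l in (0 : ℝ)..1, s l ^ (e : ℂ)) * v ^ (e : ℂ) := by
    rw [← intervalIntegral.integral_mul_const]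
    refine intervalIntegral.integral_congr fun l hl => ?_
    rw [Set.uIcc_of_le zero_le_one] at hl
    rw [← hst, mul_cpow_of_re_pos (hspos l hl) hv]
  have e2 : ∫ l in (0 : ℝ)..1, ‖(1 + l * (v ^ 2 - 1) : ℂ)‖ ^ e =
      (∫ l in (0 : ℝ)..1, ‖s l‖ ^ e) * ‖v‖ ^ e := by
    rw [← intervalIntegral.integral_mul_const]
    refine intervalIntegral.integral_congr fun l hl => ?_
    rw [← hst, norm_mul, Real.mul_rpow (norm_nonneg _) (norm_nonneg _)]
  rw [e1, e2, norm_mul, Complex.norm_cpow_real, ← mul_assoc]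
  exact mul_le_mul_of_nonneg_right hle (Real.rpow_nonneg hvn.le _)

/-- If the values of a continuous weight `ρ` on `[0, 1]` vary by a factor of at most `2`, then the
`ρ`-average of `4 l (1 - l)` is at most `4 / 5`. -/
theorem integral_parabola_mul_le {ρ : ℝ → ℝ} (hρ : ContinuousOn ρ (Set.Icc 0 1)) {m : ℝ}
    (hm : ∀ l ∈ Set.Icc (0 : ℝ) 1, m ≤ ρ l) (hm2 : ∀ l ∈ Set.Icc (0 : ℝ) 1, ρ l ≤ 2 * m)
    (hm0 : 0 ≤ m) :
    ∫ l in (0 : ℝ)..1, 4 * (l * (1 - l)) * ρ l ≤ 4 / 5 * ∫ l in (0 : ℝ)..1, ρ l := by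
  have hI : ∀ f : ℝ → ℝ, Continuous f →
      IntervalIntegrable (fun l => f l * ρ l) MeasureTheory.volume 0 1 := fun f hf =>
    ContinuousOn.intervalIntegrable (by
      rw [Set.uIcc_of_le zero_le_one]; exact hf.continuousOn.mul hρ)
  rw [← sub_nonneg, ← intervalIntegral.integral_const_mul,
    ← intervalIntegral.integral_sub (hI _ continuous_const) (hI _ (by fun_prop))]
  -- with `a = 4/5 - 4 l (1 - l)`, one has `a * ρ ≥ m * min a (2 * a)`, and the last factor is
  -- `3/2 * a - |a| / 2`, where `2 |a| ≤ 3 a ^ 2 + 1 / 3`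
  have hpoly : ∫ l in (0 : ℝ)..1, (191 / 300 - 6 / 5 * l - 54 / 5 * l ^ 2 + 24 * l ^ 3 -
      12 * l ^ 4) = 11 / 300 := by
    have hd : ∀ l ∈ Set.uIcc (0 : ℝ) 1, HasDerivAt
        (fun l : ℝ => 191 / 300 * l - 3 / 5 * l ^ 2 - 18 / 5 * l ^ 3 + 6 * l ^ 4 - 12 / 5 * l ^ 5)
        (191 / 300 - 6 / 5 * l - 54 / 5 * l ^ 2 + 24 * l ^ 3 - 12 * l ^ 4) l := fun l _ => by
      have := (((((hasDerivAt_id l).const_mul (191 / 300)).sub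
        ((hasDerivAt_pow 2 l).const_mul (3 / 5))).sub
        ((hasDerivAt_pow 3 l).const_mul (18 / 5))).add
        ((hasDerivAt_pow 4 l).const_mul 6)).sub ((hasDerivAt_pow 5 l).const_mul (12 / 5))
      convert! this using 1
      push_cast
      ring
    rw [intervalIntegral.integral_eq_sub_of_hasDerivAt hd
      (Continuous.intervalIntegrable (by fun_prop) _ _)]
    norm_num
  have hlow : 0 ≤ ∫ l in (0 : ℝ)..1, m * (191 / 300 - 6 / 5 * l - 54 / 5 * l ^ 2 + 24 * l ^ 3 -
      12 * l ^ 4) := by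
    rw [intervalIntegral.integral_const_mul, hpoly]
    positivity
  refine hlow.trans (intervalIntegral.integral_mono_on zero_le_one
    (Continuous.intervalIntegrable (by fun_prop) _ _)
    ((hI _ continuous_const).sub (hI _ (by fun_prop))) fun l hl => ?_)
  have e1 : 191 / 300 - 6 / 5 * l - 54 / 5 * l ^ 2 + 24 * l ^ 3 - 12 * l ^ 4 =
      3 / 2 * (4 / 5 - 4 * (l * (1 - l))) -
        1 / 4 * (3 * (4 / 5 - 4 * (l * (1 - l))) ^ 2 + 1 / 3) := by ring
  rw [e1, ← sub_mul]
  generalize 4 / 5 - 4 * (l * (1 - l)) = a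
  rcases le_total 0 a with ha | ha
  · have h1 : 3 / 2 * a - 1 / 4 * (3 * a ^ 2 + 1 / 3) ≤ a := by nlinarith [sq_nonneg (a - 1 / 3)]
    nlinarith [mul_le_mul_of_nonneg_left h1 hm0, mul_le_mul_of_nonneg_left (hm l hl) ha]
  · have h1 : 3 / 2 * a - 1 / 4 * (3 * a ^ 2 + 1 / 3) ≤ 2 * a := by
      nlinarith [sq_nonneg (a + 1 / 3)]
    nlinarith [mul_le_mul_of_nonneg_left h1 hm0, mul_le_mul_of_nonpos_left (hm2 l hl) ha]

theorem norm_sq_lt_two_mul_re {w : ℂ} (hw1 : ‖w - 1‖ < 1) : ‖w‖ ^ 2 < 2 * w.re := by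
  have h1 : ‖w - 1‖ ^ 2 < 1 := by
    have := norm_nonneg (w - 1); nlinarith
  rw [Complex.sq_norm, Complex.normSq_apply] at h1 ⊢
  simp only [Complex.sub_re, Complex.sub_im, Complex.one_re, Complex.one_im] at h1
  nlinarith

/-- The weight `‖t‖ ^ e` with `-1 ≤ e ≤ 0` varies by a factor of at most `2` on the segment from `1`
to `w`, since the distance of that segment to `0` is at least `max 1 ‖w‖ / 2`. -/
theorem exists_norm_rpow_bounds {w : ℂ} (hw1 : ‖w - 1‖ < 1) (hre : 1 / 2 < w.re) {e : ℝ}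
    (he : -1 ≤ e) (he0 : e ≤ 0) :
    ∃ m : ℝ, 0 ≤ m ∧ ∀ l ∈ Set.Icc (0 : ℝ) 1,
      m ≤ ‖(1 + l * (w - 1) : ℂ)‖ ^ e ∧ ‖(1 + l * (w - 1) : ℂ)‖ ^ e ≤ 2 * m := by
  have hM : 0 < max 1 ‖w‖ := lt_max_of_lt_left one_pos
  refine ⟨max 1 ‖w‖ ^ e, (Real.rpow_pos_of_pos hM _).le, fun l hl => ?_⟩
  have hl1 : 0 ≤ 1 - l := sub_nonneg.2 hl.2
  have hw2 := norm_sq_lt_two_mul_re hw1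
  have hup : ‖(1 + l * (w - 1) : ℂ)‖ ≤ max 1 ‖w‖ := by
    have e1 : (1 + l * (w - 1) : ℂ) = ((1 - l : ℝ) : ℂ) + (l : ℝ) * w := by push_cast; ring
    rw [e1]
    refine (norm_add_le _ _).trans ?_
    rw [norm_mul, Complex.norm_real, Complex.norm_real, Real.norm_of_nonneg hl1,
      Real.norm_of_nonneg hl.1]
    nlinarith [mul_le_mul_of_nonneg_left (le_max_left 1 ‖w‖) hl1,
      mul_le_mul_of_nonneg_left (le_max_right 1 ‖w‖) hl.1]
  have hlow : max 1 ‖w‖ / 2 ≤ ‖(1 + l * (w - 1) : ℂ)‖ := by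
    rcases le_total ‖w‖ 1 with h | h
    · rw [max_eq_left h]
      refine le_trans ?_ (Complex.re_le_norm _)
      simp only [Complex.add_re, Complex.one_re, Complex.re_ofReal_mul, Complex.sub_re]
      nlinarith [hl.1, hl.2]
    · rw [max_eq_right h]
      have hw0 : 0 < ‖w‖ := by linarith
      -- the projection of `t` to the direction of `w`
      have h1 : ((1 + l * (w - 1)) * (starRingEnd ℂ) w).re =
          (1 - l) * w.re + l * ‖w‖ ^ 2 := by
        rw [Complex.sq_norm, Complex.normSq_apply]
        simp only [Complex.mul_re, Complex.add_re, Complex.add_im, Complex.one_re, Complex.one_im,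
          Complex.mul_im, Complex.ofReal_re, Complex.ofReal_im, Complex.sub_re, Complex.sub_im,
          Complex.conj_re, Complex.conj_im]
        ring
      have h2 := Complex.re_le_norm ((1 + l * (w - 1)) * (starRingEnd ℂ) w)
      rw [h1, norm_mul, Complex.norm_conj] at h2
      have h3 : ‖w‖ * (‖w‖ / 2) ≤ ‖w‖ * ‖(1 + l * (w - 1) : ℂ)‖ := by
        nlinarith [hl.1, sq_nonneg ‖w‖]
      exact le_of_mul_le_mul_left h3 hw0
  have ht0 : 0 < ‖(1 + l * (w - 1) : ℂ)‖ := lt_of_lt_of_le (by positivity) hlow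
  refine ⟨Real.rpow_le_rpow_of_nonpos ht0 hup he0, ?_⟩
  refine (Real.rpow_le_rpow_of_nonpos (by positivity) hlow he0).trans ?_
  rw [Real.div_rpow hM.le zero_le_two, div_eq_mul_inv, mul_comm]
  refine mul_le_mul_of_nonneg_right ?_ (Real.rpow_pos_of_pos hM _).le
  rw [← Real.rpow_neg zero_le_two]
  calc (2 : ℝ) ^ (-e) ≤ 2 ^ (1 : ℝ) := Real.rpow_le_rpow_of_exponent_le one_le_two (by linarith)
    _ = 2 := Real.rpow_one 2

/-- Comparison of the remainder integral for `r` to that for `r = 0`. For `r ≥ 1`, the factor `4 / 5`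
gained from `4 l (1 - l)` pays for the triangle inequality. -/
theorem norm_integral_le_pow_mul {ν : ℝ} (hν : 0 < ν) (hν1 : ν < 1) (r : ℕ) {w : ℂ}
    (hw1 : ‖w - 1‖ < 1) (hre : 1 / 2 < w.re) :
    ‖∫ l in (0 : ℝ)..1, (l * (1 - l) : ℂ) ^ r * (1 + l * (w - 1) : ℂ) ^ ((ν - 1 - r : ℝ) : ℂ)‖ ≤
      (1 / (4 * (1 - ‖w - 1‖))) ^ r *
        ‖∫ l in (0 : ℝ)..1, (1 + l * (w - 1) : ℂ) ^ ((ν - 1 : ℝ) : ℂ)‖ := by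
  obtain _ | r := r
  · simp
  have hre0 : 0 < w.re := by linarith
  have hz : 0 < 1 - ‖w - 1‖ := sub_pos.2 hw1
  have hw2 : ‖w‖ ≤ 2 * w.re := by
    nlinarith [norm_nonneg w, norm_sq_lt_two_mul_re hw1]
  obtain ⟨m, hm0, hm⟩ := exists_norm_rpow_bounds hw1 hre (e := ν - 1) (by linarith) (by linarith)
  have hcont : ContinuousOn (fun l : ℝ => ‖(1 + l * (w - 1) : ℂ)‖ ^ (ν - 1)) (Set.Icc 0 1) :=
    ((continuousOn_seg_cpow hre0 ((ν - 1 : ℝ) : ℂ)).norm).congr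
      fun l _ => (Complex.norm_cpow_real _ _).symm
  have h1 := integral_parabola_mul_le hcont (fun l hl => (hm l hl).1) (fun l hl => (hm l hl).2) hm0
  have h2 := h1.trans (integral_norm_le_norm_integral hw2 hre0 (e := ν - 1)
    (by linarith) (by linarith))
  refine le_trans ?_ (mul_le_mul_of_nonneg_left h2 (by positivity))
  rw [← intervalIntegral.integral_const_mul]
  refine intervalIntegral.norm_integral_le_of_norm_le zero_le_one ?_ ?_
  · refine Filter.Eventually.of_forall fun l hl => ?_
    have hl' : l ∈ Set.Icc (0 : ℝ) 1 := ⟨hl.1.le, hl.2⟩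
    have hl1 : 0 ≤ 1 - l := sub_nonneg.2 hl.2
    have htre := seg_re_pos hre0 hl'
    set t : ℂ := 1 + l * (w - 1) with ht
    have ht0 : 0 < ‖t‖ := norm_pos_iff.2 fun h => by simp [h] at htre
    have htz : 1 - ‖w - 1‖ ≤ ‖t‖ := by
      have h3 := norm_sub_norm_le (1 : ℂ) (-(l * (w - 1)))
      rw [sub_neg_eq_add, norm_neg, norm_one, norm_mul, Complex.norm_real,
        Real.norm_of_nonneg hl'.1] at h3
      nlinarith [norm_nonneg (w - 1)]
    have hn : ‖(l * (1 - l) : ℂ)‖ = l * (1 - l) := by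
      rw [show (l * (1 - l) : ℂ) = ((l * (1 - l) : ℝ) : ℂ) by push_cast; ring, Complex.norm_real,
        Real.norm_of_nonneg (mul_nonneg hl'.1 hl1)]
    rw [norm_mul, norm_pow, Complex.norm_cpow_real, hn, Real.rpow_sub ht0, Real.rpow_natCast]
    have hφ0 : 0 ≤ 4 * (l * (1 - l)) := by have := mul_nonneg hl'.1 hl1; linarith
    have hφ1 : 4 * (l * (1 - l)) ≤ 1 := by nlinarith [sq_nonneg (2 * l - 1)]
    have hφ : (4 * (l * (1 - l))) ^ (r + 1) ≤ 4 * (l * (1 - l)) :=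
      pow_le_of_le_one hφ0 hφ1 (by omega)
    have hρ : 0 ≤ ‖t‖ ^ (ν - 1) := Real.rpow_nonneg ht0.le _
    calc (l * (1 - l)) ^ (r + 1) * (‖t‖ ^ (ν - 1) / ‖t‖ ^ (r + 1))
        = ((1 / (4 * ‖t‖)) ^ (r + 1)) * ((4 * (l * (1 - l))) ^ (r + 1) * ‖t‖ ^ (ν - 1)) := by
          generalize l * (1 - l) = y
          rw [div_pow, mul_pow, mul_pow 4 y]
          field_simp
          ring
      _ ≤ (1 / (4 * (1 - ‖w - 1‖))) ^ (r + 1) * (4 * (l * (1 - l)) * ‖t‖ ^ (ν - 1)) := by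
          gcongr
  · refine ContinuousOn.intervalIntegrable ?_
    rw [Set.uIcc_of_le zero_le_one]
    exact continuousOn_const.mul (ContinuousOn.mul (by fun_prop) hcont)

/-- The rate of approximation of `w ^ ν` by the ratio of the forms, with the constant that is sharp
for `r = 0`. -/
theorem norm_hypForm_sub_le {ν : ℝ} (hν : 0 < ν) (hν1 : ν < 1) (r : ℕ) {w : ℂ}
    (hw1 : ‖w - 1‖ < 1) (hre : 1 / 2 < w.re) :
    ‖hypForm ν r w 1 - w ^ (ν : ℂ) * hypForm ν r 1 w‖ ≤
      (∏ i ∈ Finset.range (r + 1), (ν + i)) / (ν * r.factorial) * ‖1 - w ^ (ν : ℂ)‖ *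
        (‖w - 1‖ ^ 2 / (4 * (1 - ‖w - 1‖))) ^ r := by
  have hre0 : 0 < w.re := by linarith
  have hz : 0 < 1 - ‖w - 1‖ := sub_pos.2 hw1
  have h0 := hypForm_sub_eq_integral hν hν1 0 hre0
  have hr := hypForm_sub_eq_integral hν hν1 r hre0
  have hJ := norm_integral_le_pow_mul hν hν1 r hw1 hre
  have hf0 : ∀ a b : ℂ, hypForm ν 0 a b = 1 := fun a b => by simp [hypForm, hypCoeff]
  simp only [hf0, zero_add, Finset.prod_range_one, Nat.cast_zero, add_zero, mul_zero, pow_one,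
    pow_zero, one_mul, sub_zero, Nat.factorial_zero, Nat.cast_one, mul_one] at h0
  set J := ∫ l in (0 : ℝ)..1,
    (l * (1 - l) : ℂ) ^ r * (1 + l * (w - 1) : ℂ) ^ ((ν - 1 - r : ℝ) : ℂ)
  set J0 := ∫ l in (0 : ℝ)..1, (1 + l * (w - 1) : ℂ) ^ ((ν - 1 : ℝ) : ℂ)
  have hP : 0 < ∏ i ∈ Finset.range (r + 1), (ν + (i : ℝ)) :=
    Finset.prod_pos fun i _ => by positivity
  set P := ∏ i ∈ Finset.range (r + 1), (ν + (i : ℝ))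
  have hfac : (0 : ℝ) < r.factorial := by exact_mod_cast r.factorial_pos
  have n0 := congrArg norm h0
  have nr := congrArg norm hr
  rw [norm_mul, norm_mul, Complex.norm_real, Real.norm_of_nonneg hν.le, 
    norm_sub_rev (w ^ (ν : ℂ))] at n0
  rw [norm_mul, norm_mul, norm_mul, Complex.norm_real, Real.norm_of_nonneg hP.le, norm_pow,
    Complex.norm_natCast, norm_sub_rev (w ^ (ν : ℂ) * _)] at nr
  rw [← n0]
  calc _ = P / r.factorial * ‖w - 1‖ ^ (2 * r + 1) * ‖J‖ := by
        field_simp; linear_combination -nr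
    _ ≤ P / r.factorial * ‖w - 1‖ ^ (2 * r + 1) * ((1 / (4 * (1 - ‖w - 1‖))) ^ r * ‖J0‖) := by
        gcongr
    _ = _ := by
        rw [div_pow, div_pow, one_pow, pow_succ, pow_mul]; field_simp

/-! ### Independence of consecutive approximations -/

/-- A polynomial which is `O((z - a) ^ m)` along a sequence tending to `a` is divisible by
`(X - a) ^ m`. -/
theorem X_sub_C_pow_dvd_of_norm_eval_le {P : ℂ[X]} {m : ℕ} {a : ℂ} {u : ℕ → ℂ} {M : ℝ}
    (hu : Filter.Tendsto u Filter.atTop (nhds a)) (hua : ∀ k, u k ≠ a)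
    (hP : ∀ k, ‖P.eval (u k)‖ ≤ M * ‖u k - a‖ ^ m) : (X - C a) ^ m ∣ P := by
  by_cases hP0 : P = 0
  · simp [hP0]
  rw [← Polynomial.le_rootMultiplicity_iff hP0]
  by_contra hlt
  push Not at hlt
  obtain ⟨q, hq⟩ := Polynomial.pow_rootMultiplicity_dvd P a
  set j := P.rootMultiplicity a
  have hqa : q.eval a ≠ 0 := by
    have := Polynomial.eval_divByMonic_pow_rootMultiplicity_ne_zero a hP0
    have e : P /ₘ (X - C a) ^ j = q := by
      conv_lhs => rw [hq]
      exact Polynomial.mul_divByMonic_cancel_left _ ((monic_X_sub_C a).pow _)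
    rwa [e] at this
  obtain ⟨i, hi⟩ : ∃ i, m = j + (i + 1) := ⟨m - j - 1, by omega⟩
  have hle : ∀ k, ‖q.eval (u k)‖ ≤ M * ‖u k - a‖ ^ (i + 1) := fun k => by
    have h1 := hP k
    have hpos : 0 < ‖u k - a‖ ^ j := pow_pos (norm_pos_iff.2 (sub_ne_zero.2 (hua k))) _
    rw [hq, hi] at h1
    simp only [eval_mul, eval_pow, eval_sub, eval_X, eval_C, norm_mul, norm_pow] at h1
    rw [pow_add] at h1
    refine le_of_mul_le_mul_left (h1.trans_eq ?_) hpos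
    ring
  have hlim : Filter.Tendsto (fun k => M * ‖u k - a‖ ^ (i + 1)) Filter.atTop (nhds 0) := by
    have h1 : Filter.Tendsto (fun k => ‖u k - a‖) Filter.atTop (nhds 0) := by
      rw [← tendsto_iff_norm_sub_tendsto_zero]; exact hu
    have := (h1.pow (i + 1)).const_mul M
    simpa using this
  have hq0 : Filter.Tendsto (fun k => q.eval (u k)) Filter.atTop (nhds 0) :=
    squeeze_zero_norm hle hlim
  exact hqa (tendsto_nhds_unique ((q.continuous.tendsto a).comp hu) hq0)

/-- The polynomial `₂F₁(-r, -r - ν; 1 - ν; x)` with complex coefficients. -/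
noncomputable def hypPoly (ν : ℝ) (r : ℕ) : ℂ[X] :=
  ∑ k ∈ Finset.range (r + 1), C (hypCoeff ν r k : ℂ) * X ^ k

/-- The reversal `x ^ r * ₂F₁(-r, -r - ν; 1 - ν; 1 / x)`. -/
noncomputable def hypPolyRev (ν : ℝ) (r : ℕ) : ℂ[X] :=
  ∑ k ∈ Finset.range (r + 1), C (hypCoeff ν r k : ℂ) * X ^ (r - k)

theorem eval_hypPoly (ν : ℝ) (r : ℕ) (w : ℂ) : (hypPoly ν r).eval w = hypForm ν r w 1 := by
  simp [hypPoly, hypForm, eval_finsetSum]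

theorem eval_hypPolyRev (ν : ℝ) (r : ℕ) (w : ℂ) : (hypPolyRev ν r).eval w = hypForm ν r 1 w := by
  simp [hypPolyRev, hypForm, eval_finsetSum]

theorem natDegree_hypPoly_le (ν : ℝ) (r : ℕ) : (hypPoly ν r).natDegree ≤ r :=
  natDegree_sum_le_of_forall_le _ _ fun _ hk =>
    (natDegree_C_mul_X_pow_le _ _).trans (Finset.mem_range_succ_iff.1 hk)

theorem natDegree_hypPolyRev_le (ν : ℝ) (r : ℕ) : (hypPolyRev ν r).natDegree ≤ r :=
  natDegree_sum_le_of_forall_le _ _ fun _ _ =>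
    (natDegree_C_mul_X_pow_le _ _).trans (Nat.sub_le _ _)

/-- Consecutive approximations to `w ^ ν` are never proportional: the determinant below is a
polynomial in `w` of degree at most `2 r + 1` that vanishes to order `2 r + 1` at `1`, but not at
`0`. -/
theorem hypForm_det_ne_zero {ν : ℝ} (hν : 0 < ν) (hν1 : ν < 1) (r : ℕ) {w : ℂ} (hw : w ≠ 1) :
    hypForm ν r w 1 * hypForm ν (r + 1) 1 w - hypForm ν (r + 1) w 1 * hypForm ν r 1 w ≠ 0 := by
  set V : ℂ[X] := hypPoly ν r * hypPolyRev ν (r + 1) - hypPoly ν (r + 1) * hypPolyRev ν r with hV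
  have hVeval : ∀ z, V.eval z = hypForm ν r z 1 * hypForm ν (r + 1) 1 z -
      hypForm ν (r + 1) z 1 * hypForm ν r 1 z := fun z => by
    simp [hV, eval_hypPoly, eval_hypPolyRev]
  have hdeg : V.natDegree ≤ 2 * r + 1 := by
    refine (natDegree_sub_le _ _).trans (max_le ?_ ?_)
    · refine natDegree_mul_le.trans ?_
      have := natDegree_hypPoly_le ν r
      have := natDegree_hypPolyRev_le ν (r + 1)
      omega
    · refine natDegree_mul_le.trans ?_
      have := natDegree_hypPoly_le ν (r + 1)
      have := natDegree_hypPolyRev_le ν r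
      omega
  have hV0 : V.eval 0 ≠ 0 := by
    have e1 : ∀ s : ℕ, hypForm ν s 0 1 = 1 := fun s => by
      unfold hypForm
      rw [Finset.sum_eq_single 0]
      · simp [hypCoeff]
      · intro k _ hk; simp [hk]
      · simp
    have e2 : ∀ s : ℕ, hypForm ν s 1 0 = hypCoeff ν s s := fun s => by
      unfold hypForm
      rw [Finset.sum_eq_single s]
      · simp
      · intro k hk hks
        have := Finset.mem_range_succ_iff.1 hk
        rw [zero_pow (by omega), mul_zero]
      · simp
    rw [hVeval, e1, e1, e2, e2, one_mul, one_mul, sub_ne_zero]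
    exact_mod_cast (hypCoeff_self_lt hν hν1 r).ne'
  have hdvd : (X - C (1 : ℂ)) ^ (2 * r + 1) ∣ V := by
    -- points `u k = 1 + 1 / (k + 2)`
    set u : ℕ → ℂ := fun k => 1 + ((1 / ((k : ℝ) + 2) : ℝ) : ℂ) with hu
    have hpos : ∀ k : ℕ, (0 : ℝ) < 1 / ((k : ℝ) + 2) := fun k => by positivity
    have hle : ∀ k : ℕ, 1 / ((k : ℝ) + 2) ≤ 1 / 2 := fun k => by
      gcongr; linarith [(k.cast_nonneg : (0 : ℝ) ≤ k)]
    have hun : ∀ k, ‖u k - 1‖ = 1 / ((k : ℝ) + 2) := fun k => by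
      simp only [hu, add_sub_cancel_left, Complex.norm_real, Real.norm_of_nonneg (hpos k).le]
    have hlim : Filter.Tendsto u Filter.atTop (nhds 1) := by
      rw [tendsto_iff_norm_sub_tendsto_zero]
      simp only [hun]
      have := tendsto_one_div_add_atTop_nhds_zero_nat (𝕜 := ℝ)
      have h2 := this.comp (Filter.tendsto_add_atTop_nat 1)
      refine h2.congr fun k => ?_
      simp only [Function.comp]
      push_cast
      ring_nf
    have hre : ∀ k, 1 / 2 < (u k).re := fun k => by
      simp only [hu, Complex.add_re, Complex.one_re, Complex.ofReal_re]
      linarith [hpos k]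
    have hlt : ∀ k, ‖u k - 1‖ < 1 := fun k => by rw [hun]; linarith [hle k]
    -- the error term is `O((w - 1) ^ (2 s + 1))` along the sequence
    have herr : ∀ s : ℕ, ∃ M : ℝ, 0 ≤ M ∧ ∀ k,
        ‖hypForm ν s (u k) 1 - u k ^ (ν : ℂ) * hypForm ν s 1 (u k)‖ ≤
          M * ‖u k - 1‖ ^ (2 * s + 1) := fun s => by
      refine ⟨(∏ i ∈ Finset.range (s + 1), (ν + i)) / (ν * s.factorial) * 1,
        by positivity, fun k => ?_⟩
      refine (norm_hypForm_sub_le hν hν1 s (hlt k) (hre k)).trans ?_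
      have hy0 := hpos k
      have hy1 := hle k
      have h1 : ‖1 - u k ^ (ν : ℂ)‖ ≤ ‖u k - 1‖ := by
        have hbase : u k = ((1 + 1 / ((k : ℝ) + 2) : ℝ) : ℂ) := by simp [hu]
        rw [hun, hbase, ← Complex.ofReal_cpow (by linarith), ← Complex.ofReal_one,
          ← Complex.ofReal_sub, Complex.norm_real, Real.norm_eq_abs, abs_sub_comm, abs_le]
        have h2 := Real.one_le_rpow (show 1 ≤ 1 + 1 / ((k : ℝ) + 2) by linarith) hν.le
        have h3 := Real.rpow_le_rpow_of_exponent_le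
          (show 1 ≤ 1 + 1 / ((k : ℝ) + 2) by linarith) hν1.le
        rw [Real.rpow_one] at h3
        constructor <;> linarith
      have h2 : ‖u k - 1‖ ^ 2 / (4 * (1 - ‖u k - 1‖)) ≤ ‖u k - 1‖ ^ 2 := by
        refine div_le_self (by positivity) ?_
        rw [hun]; linarith
      have h3 : 0 ≤ 1 - ‖u k - 1‖ := by linarith [hlt k]
      calc _ ≤ (∏ i ∈ Finset.range (s + 1), (ν + i)) / (ν * s.factorial) * ‖u k - 1‖ *
            (‖u k - 1‖ ^ 2) ^ s := by gcongr
        _ = _ := by rw [← pow_mul]; ring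
    obtain ⟨M, hM, hM'⟩ := herr r
    obtain ⟨M₁, hM₁, hM₁'⟩ := herr (r + 1)
    have hbdd : ∀ s : ℕ, ∃ B : ℝ, 0 ≤ B ∧ ∀ k, ‖hypForm ν s 1 (u k)‖ ≤ B := fun s => by
      have : Filter.Tendsto (fun k => hypForm ν s 1 (u k)) Filter.atTop
          (nhds ((hypPolyRev ν s).eval 1)) := by
        simp only [← eval_hypPolyRev]
        exact ((hypPolyRev ν s).continuous.tendsto 1).comp hlim
      obtain ⟨B, hB⟩ := (Metric.isBounded_range_of_tendsto _ this).exists_norm_le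
      exact ⟨B, (norm_nonneg _).trans (hB _ ⟨0, rfl⟩), fun k => hB _ ⟨k, rfl⟩⟩
    obtain ⟨B, hB, hB'⟩ := hbdd r
    obtain ⟨B₁, hB₁, hB₁'⟩ := hbdd (r + 1)
    refine X_sub_C_pow_dvd_of_norm_eval_le (M := M * B₁ + M₁ * B) hlim (fun k h => ?_) fun k => ?_
    · have := hpos k
      rw [← hun, h, sub_self, norm_zero] at this
      exact lt_irrefl _ this
    · have e : V.eval (u k) =
          (hypForm ν r (u k) 1 - u k ^ (ν : ℂ) * hypForm ν r 1 (u k)) * hypForm ν (r + 1) 1 (u k) -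
          (hypForm ν (r + 1) (u k) 1 - u k ^ (ν : ℂ) * hypForm ν (r + 1) 1 (u k)) *
            hypForm ν r 1 (u k) := by rw [hVeval]; ring
      have h1 : ‖u k - 1‖ ^ (2 * (r + 1) + 1) ≤ ‖u k - 1‖ ^ (2 * r + 1) :=
        pow_le_pow_of_le_one (norm_nonneg _) (hlt k).le (by omega)
      rw [e, add_mul]
      refine (norm_sub_le _ _).trans (add_le_add ?_ ?_)
      · rw [norm_mul]
        calc _ ≤ (M * ‖u k - 1‖ ^ (2 * r + 1)) * B₁ := by
              gcongr
              · exact hM' k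
              · exact hB₁' k
          _ = _ := by ring
      · rw [norm_mul]
        calc _ ≤ (M₁ * ‖u k - 1‖ ^ (2 * r + 1)) * B := by
              gcongr
              · exact (hM₁' k).trans (mul_le_mul_of_nonneg_left h1 hM₁)
              · exact hB' k
          _ = _ := by ring
  obtain ⟨S, hS⟩ := hdvd
  have hS0 : S ≠ 0 := by
    rintro rfl
    rw [hS] at hV0
    simp at hV0
  have hSdeg : S.natDegree = 0 := by
    rw [hS, (((monic_X_sub_C (1 : ℂ)).pow _).natDegree_mul' hS0), natDegree_pow,
      natDegree_X_sub_C] at hdeg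
    omega
  rw [← hVeval, hS, eval_mul, eq_C_of_natDegree_eq_zero hSdeg]
  refine mul_ne_zero ?_ ?_
  · simpa using sub_ne_zero.2 hw
  · rw [eval_C]
    intro h
    exact hS0 (by rw [eq_C_of_natDegree_eq_zero hSdeg, h, C_0])

/-! ### Denominators, numerators and integrality -/

theorem Real.Gamma_add_nat_eq_prod_mul {y : ℝ} (hy : 0 < y) (k : ℕ) :
    Real.Gamma (y + k) = (∏ i ∈ Finset.range k, (y + i)) * Real.Gamma y := by
  induction k with
  | zero => simp
  | succ k ih =>
    rw [Finset.prod_range_succ, Nat.cast_succ, ← add_assoc, Real.Gamma_add_one (by positivity), ih]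
    ring

theorem gamma_ratio_left {n : ℕ} (hn : 2 ≤ n) (r : ℕ) :
    Real.Gamma (1 - 1 / n) * r.factorial / Real.Gamma (r + 1 - 1 / n) =
      r.factorial / ∏ m ∈ Finset.range r, ((m : ℝ) + 1 - 1 / n) := by
  have hn' : (2 : ℝ) ≤ n := by exact_mod_cast hn
  have h1 : (1 : ℝ) / n ≤ 1 / 2 := one_div_le_one_div_of_le two_pos hn'
  have hy : (0 : ℝ) < 1 - 1 / n := by linarith
  have hg := Real.Gamma_pos_of_pos hy
  rw [show (r : ℝ) + 1 - 1 / n = 1 - 1 / n + r by ring, Real.Gamma_add_nat_eq_prod_mul hy,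
    Finset.prod_congr rfl fun (m : ℕ) _ => show (1 : ℝ) - 1 / n + m = m + 1 - 1 / n by ring]
  have hp : (∏ m ∈ Finset.range r, ((m : ℝ) + 1 - 1 / n)) ≠ 0 :=
    (prod_add_one_sub_pos (show (1 : ℝ) / n < 1 by linarith) r).ne'
  rw [mul_comm (Real.Gamma _), mul_div_mul_right _ _ hg.ne']

theorem gamma_ratio_right {n : ℕ} (hn : 0 < n) (r : ℕ) :
    n * Real.Gamma (r + 1 + 1 / n) / (Real.Gamma (1 / n) * r.factorial) =
      (∏ i ∈ Finset.range (r + 1), ((1 : ℝ) / n + i)) / (1 / n * r.factorial) := by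
  have hn' : (0 : ℝ) < n := by exact_mod_cast hn
  have hy : (0 : ℝ) < 1 / n := by positivity
  have hg := Real.Gamma_pos_of_pos hy
  rw [show (r : ℝ) + 1 + 1 / n = 1 / n + (r + 1 : ℕ) by push_cast; ring,
    Real.Gamma_add_nat_eq_prod_mul hy]
  set P := ∏ i ∈ Finset.range (r + 1), ((1 : ℝ) / n + i)
  have hfac : (0 : ℝ) < r.factorial := by exact_mod_cast r.factorial_pos
  field_simp

theorem ascPochhammer_eval_eq_prod {F : Type*} [Field F] (y : F) (k : ℕ) :
    (ascPochhammer F k).eval y = ∏ m ∈ Finset.range k, (y + m) := by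
  induction k with
  | zero => simp
  | succ k ih => rw [ascPochhammer_succ_eval, ih, Finset.prod_range_succ]

theorem coeff_hypX (n r k : ℕ) : (((hypX n r).coeff k : ℚ) : ℝ) = hypCoeff (1 / n) r k := by
  have h0 : (hypX n r).coeff k = if k < r + 1 then
      ordinaryHypergeometricCoefficient (-(r : ℚ)) (-(r : ℚ) - 1 / n) (1 - 1 / n) k else 0 := by
    simp only [hypX, finsetSum_coeff, coeff_C_mul, coeff_X_pow, mul_ite, mul_one, mul_zero,
      Finset.sum_ite_eq, Finset.mem_range]
  have h1 : ordinaryHypergeometricCoefficient (-(r : ℚ)) (-(r : ℚ) - 1 / n) (1 - 1 / n) k =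
      r.choose k * ∏ m ∈ Finset.range k, ((r : ℚ) + 1 / n - m) / (m + 1 - 1 / n) := by
    have hfac : (k.factorial : ℚ) ≠ 0 := by exact_mod_cast k.factorial_ne_zero
    have e1 : ∏ m ∈ Finset.range k, (-(r : ℚ) - 1 / n + m) =
        (-1) ^ k * ∏ m ∈ Finset.range k, ((r : ℚ) + 1 / n - m) := by
      rw [← Finset.card_range k, ← Finset.prod_const, Finset.card_range,
        ← Finset.prod_mul_distrib]
      exact Finset.prod_congr rfl fun m _ => by ring
    have e2 : ∏ m ∈ Finset.range k, ((1 : ℚ) - 1 / n + m) =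
        ∏ m ∈ Finset.range k, ((m : ℚ) + 1 - 1 / n) :=
      Finset.prod_congr rfl fun m _ => by ring
    have e3 : ((-1 : ℚ) ^ k) * (-1) ^ k = 1 := by rw [← mul_pow]; simp
    simp only [ordinaryHypergeometricCoefficient]
    rw [ascPochhammer_eval_neg_eq_descPochhammer, descPochhammer_eval_eq_descFactorial,
      Nat.descFactorial_eq_factorial_mul_choose, ascPochhammer_eval_eq_prod,
      ascPochhammer_eval_eq_prod, e1, e2, Finset.prod_div_distrib, div_eq_mul_inv]
    push_cast
    calc _ = ((k.factorial : ℚ)⁻¹ * k.factorial) * ((-1 : ℚ) ^ k * (-1) ^ k) * (r.choose k *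
          ((∏ m ∈ Finset.range k, ((r : ℚ) + 1 / n - m)) *
            (∏ m ∈ Finset.range k, ((m : ℚ) + 1 - 1 / n))⁻¹)) := by ring_nf
      _ = _ := by rw [inv_mul_cancel₀ hfac, e3]; ring_nf
  rw [h0]
  split_ifs with hk
  · rw [h1, hypCoeff]
    push_cast
    rfl
  · rw [hypCoeff, Nat.choose_eq_zero_of_lt (by omega)]
    simp

theorem natDegree_hypX_le (n r : ℕ) : (hypX n r).natDegree ≤ r :=
  natDegree_sum_le_of_forall_le _ _ fun _ hk =>
    (natDegree_C_mul_X_pow_le _ _).trans (Finset.mem_range_succ_iff.1 hk)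

theorem hypX_ne_zero (n r : ℕ) : hypX n r ≠ 0 := fun h => by
  have := coeff_hypX n r 0
  rw [h] at this
  simp [hypCoeff] at this

theorem hypDenom_spec (n r : ℕ) :
    0 < hypDenom n r ∧ ∀ k : ℕ, ∃ z : ℤ, (hypDenom n r : ℚ) * (hypX n r).coeff k = z := by
  refine Nat.sInf_mem (s := {D : ℕ | 0 < D ∧ ∀ k : ℕ, ∃ z : ℤ, (D : ℚ) * (hypX n r).coeff k = z})
    ⟨∏ k ∈ Finset.range (r + 1), ((hypX n r).coeff k).den,
      Finset.prod_pos fun k _ => Rat.den_pos _, fun k => ?_⟩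
  by_cases hk : k < r + 1
  · obtain ⟨c, hc⟩ := Finset.dvd_prod_of_mem (fun k => ((hypX n r).coeff k).den)
      (Finset.mem_range.2 hk)
    rw [hc]
    refine ⟨c * ((hypX n r).coeff k).num, ?_⟩
    have := Rat.den_mul_eq_num ((hypX n r).coeff k)
    push_cast
    linear_combination (c : ℚ) * this
  · rw [coeff_eq_zero_of_natDegree_lt (lt_of_le_of_lt (natDegree_hypX_le n r) (by omega))]
    exact ⟨0, by simp⟩

theorem hypDenom_mul_coeff_comp (n r d : ℕ) (k : ℕ) : ∃ z : ℤ,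
    (hypDenom n r : ℚ) * ((hypX n r).comp (1 - C (d : ℚ) * X)).coeff k = z := by
  obtain ⟨P, hP⟩ : C (hypDenom n r : ℚ) * hypX n r ∈ lifts (Int.castRingHom ℚ) := by
    rw [lifts_iff_coeff_lifts]
    intro k
    obtain ⟨z, hz⟩ := (hypDenom_spec n r).2 k
    exact ⟨z, by rw [coeff_C_mul, hz]; rfl⟩
  refine ⟨(P.comp (1 - C (d : ℤ) * X)).coeff k, ?_⟩
  have h1 : ((P.comp (1 - C (d : ℤ) * X)).map (Int.castRingHom ℚ)).coeff k =
      (hypDenom n r : ℚ) * ((hypX n r).comp (1 - C (d : ℚ) * X)).coeff k := by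
    rw [Polynomial.map_comp]
    change P.map (Int.castRingHom ℚ) = _ at hP
    rw [hP, mul_comp, C_comp, coeff_C_mul]
    simp
  rw [← h1, coeff_map]
  rfl

theorem natDegree_hypX_comp_le (n r d : ℕ) :
    ((hypX n r).comp (1 - C (d : ℚ) * X)).natDegree ≤ r := by
  refine natDegree_comp_le.trans ?_
  have h1 : (1 - C (d : ℚ) * X).natDegree ≤ 1 := by
    refine (natDegree_sub_le _ _).trans (max_le (by simp) ?_)
    exact (natDegree_C_mul_le _ _).trans natDegree_X_le
  calc _ ≤ r * 1 := Nat.mul_le_mul (natDegree_hypX_le n r) h1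
    _ = r := mul_one r

theorem hypNumer_ne_zero {d : ℕ} (hd : 0 < d) (n r : ℕ) : hypNumer d n r ≠ 0 := by
  intro h
  rw [hypNumer, Finset.gcd_eq_zero_iff] at h
  have h0 : (hypX n r).comp (1 - C (d : ℚ) * X) = 0 := by
    ext k
    by_cases hk : k < r + 1
    · simpa using h k (Finset.mem_range.2 hk)
    · rw [coeff_eq_zero_of_natDegree_lt (lt_of_le_of_lt (natDegree_hypX_comp_le n r d) (by omega)),
        coeff_zero]
  rcases comp_eq_zero_iff.1 h0 with h1 | ⟨_, h1⟩
  · exact hypX_ne_zero n r h1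
  · have := congrArg (fun p => p.coeff 1) h1
    simp [coeff_one] at this
    omega

theorem exists_int_eq_denom_div_numer_mul (d n r k : ℕ) : ∃ z : ℤ,
    (hypDenom n r : ℚ) / hypNumer d n r * ((hypX n r).comp (1 - C (d : ℚ) * X)).coeff k = z := by
  by_cases hN : hypNumer d n r = 0
  · exact ⟨0, by simp [hN]⟩
  set c := ((hypX n r).comp (1 - C (d : ℚ) * X)).coeff k with hc
  by_cases hk : k < r + 1
  · obtain ⟨z, hz⟩ := hypDenom_mul_coeff_comp n r d k
    rw [← hc] at hz
    have hden : (c.den : ℤ) ∣ hypDenom n r := by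
      have h1 : (hypDenom n r : ℤ) * c.num = z * c.den := by
        have := Rat.mul_den_eq_num c
        have h2 : ((hypDenom n r : ℤ) * c.num : ℚ) = z * c.den := by
          rw [← hz, ← this]; push_cast; ring
        exact_mod_cast h2
      have h3 : (c.den : ℤ) ∣ hypDenom n r * c.num := ⟨z, by rw [h1, mul_comm]⟩
      refine IsCoprime.dvd_of_dvd_mul_right ?_ h3
      rw [Int.isCoprime_iff_nat_coprime]
      simpa using c.reduced.symm
    have hnum : (hypNumer d n r : ℤ) ∣ c.num := by
      rw [Int.natCast_dvd]
      exact Finset.gcd_dvd (f := fun k =>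
        (((hypX n r).comp (1 - C (d : ℚ) * X)).coeff k).num.natAbs) (Finset.mem_range.2 hk)
    obtain ⟨a, ha⟩ := hden
    obtain ⟨b, hb⟩ := hnum
    refine ⟨a * b, ?_⟩
    have hN' : (hypNumer d n r : ℚ) ≠ 0 := by exact_mod_cast hN
    have hD' : (hypDenom n r : ℚ) = c.den * a := by exact_mod_cast ha
    have hb' : (c.num : ℚ) = hypNumer d n r * b := by exact_mod_cast hb
    have h4 := Rat.mul_den_eq_num c
    rw [hb'] at h4
    rw [hD']
    push_cast
    field_simp
    linear_combination (a : ℚ) * h4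
  · refine ⟨0, ?_⟩
    rw [hc, coeff_eq_zero_of_natDegree_lt
      (lt_of_le_of_lt (natDegree_hypX_comp_le n r d) (by omega))]
    simp

/-- The form `hypForm` in terms of the coefficients of `X_{n,r}(1 - d y)`. -/
theorem hypForm_eq_sum_comp {n r d : ℕ} (hd : 0 < d) {a b : ℂ} (hb : b ≠ 0) :
    hypForm (1 / n) r a b = ∑ k ∈ Finset.range (r + 1),
      (((hypX n r).comp (1 - C (d : ℚ) * X)).coeff k : ℂ) * ((b - a) / d) ^ k * b ^ (r - k) := by
  have hd' : (d : ℂ) ≠ 0 := by exact_mod_cast hd.ne'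
  have h1 : aeval (a / b) (hypX n r) =
      aeval ((b - a) / (d * b)) ((hypX n r).comp (1 - C (d : ℚ) * X)) := by
    rw [aeval_comp]
    congr 1
    simp only [map_sub, map_one, map_mul, aeval_C, aeval_X]
    simp only [map_natCast]
    field_simp
    ring_nf
  rw [aeval_eq_sum_range' (Nat.lt_succ_of_le (natDegree_hypX_le n r)),
    aeval_eq_sum_range' (Nat.lt_succ_of_le (natDegree_hypX_comp_le n r d))] at h1
  have h2 := congrArg (fun y => b ^ r * y) h1
  simp only [Finset.mul_sum] at h2
  unfold hypForm
  convert! h2 using 1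
  · refine Finset.sum_congr rfl fun k hk => ?_
    rw [← pow_sub_mul_pow b (Finset.mem_range_succ_iff.1 hk), ← coeff_hypX, Algebra.smul_def,
      div_pow]
    simp only [eq_ratCast, Complex.ofReal_ratCast]
    field_simp
  · refine Finset.sum_congr rfl fun k hk => ?_
    rw [← pow_sub_mul_pow b (Finset.mem_range_succ_iff.1 hk), Algebra.smul_def, div_pow, div_pow,
      mul_pow]
    simp only [eq_ratCast]
    field_simp

/-- Replacing `X_{n,r}(x)` by `X_{n,r}(1 - d y)` allows the common factor `N_{d,n,r}` of the
coefficients to be removed, while keeping algebraic integrality. -/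
theorem isIntegral_denom_div_numer_mul_hypForm {n r d : ℕ} (hd : 0 < d) {a b g : ℂ} (hb : b ≠ 0)
    (hg : g ≠ 0) (hbg : IsIntegral ℤ (b / g)) (hbag : IsIntegral ℤ ((b - a) / (d * g))) :
    IsIntegral ℤ ((hypDenom n r : ℂ) / hypNumer d n r * hypForm (1 / n) r a b / g ^ r) := by
  rw [hypForm_eq_sum_comp hd hb, Finset.mul_sum, Finset.sum_div]
  refine IsIntegral.sum _ fun k hk => ?_
  obtain ⟨z, hz⟩ := exists_int_eq_denom_div_numer_mul d n r k
  have hz' := congrArg (fun q : ℚ => (q : ℂ)) hz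
  push_cast at hz'
  have hd' : (d : ℂ) ≠ 0 := by exact_mod_cast hd.ne'
  have e : (hypDenom n r : ℂ) / hypNumer d n r *
      ((((hypX n r).comp (1 - C (d : ℚ) * X)).coeff k : ℂ) * ((b - a) / d) ^ k * b ^ (r - k)) /
        g ^ r = z * ((b - a) / (d * g)) ^ k * (b / g) ^ (r - k) := by
    rw [← hz', ← pow_sub_mul_pow g (Finset.mem_range_succ_iff.1 hk), div_pow, div_pow, div_pow,
      mul_pow]
    field_simp
  rw [e]
  have hzi : IsIntegral ℤ (z : ℂ) := isIntegral_algebraMap (R := ℤ) (A := ℂ) (x := z)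
  exact (hzi.mul (hbag.pow k)).mul (hbg.pow (r - k))

/-! ### Imaginary quadratic fields and quadratic extensions -/

/-- The norm of a quadratic number field as the product over its two complex embeddings. -/
theorem algebraMap_norm_eq_mul {k : Type*} [Field k] [Algebra ℚ k] (h2 : Module.finrank ℚ k = 2)
    {φ ψ : k →+* ℂ} (hne : φ ≠ ψ) (y : k) :
    algebraMap ℚ ℂ (Algebra.norm ℚ y) = φ y * ψ y := by
  classical
  have : FiniteDimensional ℚ k := Module.finite_of_finrank_pos (by omega)
  have hne' : φ.toRatAlgHom ≠ ψ.toRatAlgHom := fun h => hne (by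
    ext z
    exact DFunLike.congr_fun h z)
  have huniv : (Finset.univ : Finset (k →ₐ[ℚ] ℂ)) = {φ.toRatAlgHom, ψ.toRatAlgHom} := by
    symm
    apply Finset.eq_univ_of_card
    rw [Finset.card_pair hne', AlgHom.card, h2]
  rw [Algebra.norm_eq_prod_embeddings ℚ ℂ y, huniv, Finset.prod_pair hne']
  rfl

/-- A non-zero algebraic integer of an imaginary quadratic field has absolute value at least `1`,
because its norm is its squared absolute value. -/
theorem one_le_norm_of_isIntegral {K : IntermediateField ℚ ℂ} (hK : IsImaginaryQuadratic K) {z : ℂ}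
    (hzK : z ∈ K) (hz : IsIntegral ℤ z) (hz0 : z ≠ 0) : 1 ≤ ‖z‖ := by
  obtain ⟨hdeg, u, huK, hu⟩ := hK
  set y : K := ⟨z, hzK⟩ with hy
  have hne : algebraMap K ℂ ≠ (starRingEnd ℂ).comp (algebraMap K ℂ) := fun h => by
    have h2 : u = (starRingEnd ℂ) u := DFunLike.congr_fun h (⟨u, huK⟩ : K)
    exact hu (Complex.conj_eq_iff_im.1 h2.symm)
  have hnorm := algebraMap_norm_eq_mul hdeg hne y
  have hval : algebraMap K ℂ y = z := rfl
  rw [RingHom.comp_apply, hval, Complex.mul_conj] at hnorm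
  have hyint : IsIntegral ℤ y := by
    have h1 : IsIntegral ℤ (algebraMap K ℂ y) := hz
    exact (isIntegral_algebraMap_iff (algebraMap K ℂ).injective).1 h1
  obtain ⟨m, hm⟩ := IsIntegrallyClosed.isIntegral_iff.1 (Algebra.isIntegral_norm ℚ hyint)
  rw [← hm] at hnorm
  have h2 : ((m : ℤ) : ℝ) = Complex.normSq z := by
    have : ((m : ℤ) : ℂ) = ((Complex.normSq z : ℝ) : ℂ) := by simpa using hnorm
    exact_mod_cast this
  have hpos : 0 < Complex.normSq z := Complex.normSq_pos.2 hz0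
  have hm1 : 1 ≤ m := by
    have : (0 : ℝ) < m := h2 ▸ hpos
    exact_mod_cast this
  have h3 : 1 ≤ ‖z‖ ^ 2 := by
    rw [Complex.sq_norm, ← h2]; exact_mod_cast hm1
  nlinarith [norm_nonneg z]

/-- The homogenised polynomial `b ^ r * X_{n,r}(a / b)` over an arbitrary field of characteristic
zero, on which ring homomorphisms act coordinatewise. -/
noncomputable def ratForm {F : Type*} [Field F] (n r : ℕ) (a b : F) : F :=
  ∑ k ∈ Finset.range (r + 1), ((hypX n r).coeff k : F) * a ^ k * b ^ (r - k)

theorem map_ratForm {F G : Type*} [Field F] [Field G] [CharZero F] [CharZero G] (f : F →+* G)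
    (n r : ℕ) (a b : F) : f (ratForm n r a b) = ratForm n r (f a) (f b) := by
  simp [ratForm, map_sum]

theorem ratForm_neg_neg {F : Type*} [Field F] (n r : ℕ) (a b : F) :
    ratForm n r (-a) (-b) = (-1) ^ r * ratForm n r a b := by
  unfold ratForm
  rw [Finset.mul_sum]
  refine Finset.sum_congr rfl fun k hk => ?_
  rw [← pow_sub_mul_pow (-1 : F) (Finset.mem_range_succ_iff.1 hk), neg_pow a, neg_pow b]
  ring

theorem ratForm_eq_hypForm (n r : ℕ) (a b : ℂ) : ratForm n r a b = hypForm (1 / n) r a b := by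
  unfold ratForm hypForm
  refine Finset.sum_congr rfl fun k _ => ?_
  rw [← coeff_hypX, Complex.ofReal_ratCast]

theorem hypForm_mem {K : IntermediateField ℚ ℂ} {a b : ℂ} (ha : a ∈ K) (hb : b ∈ K) (n r : ℕ) :
    hypForm (1 / n) r a b ∈ K := by
  have : hypForm (1 / n) r a b = ((ratForm n r (⟨a, ha⟩ : K) ⟨b, hb⟩ : K) : ℂ) := by
    rw [← ratForm_eq_hypForm]
    exact (map_ratForm (algebraMap K ℂ) n r ⟨a, ha⟩ ⟨b, hb⟩).symm
  rw [this]
  exact SetLike.coe_mem _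

section QuadraticExtension

variable {K L : Type*} [Field K] [Field L] [Algebra K L]

theorem algEquiv_eq_of_ne_refl (h2 : Module.finrank K L = 2) {σ ρ : L ≃ₐ[K] L}
    (hσ : σ ≠ AlgEquiv.refl) (hρ : ρ ≠ AlgEquiv.refl) : ρ = σ := by
  classical
  have : FiniteDimensional K L := Module.finite_of_finrank_pos (by omega)
  by_contra hne
  have h1 : ({AlgEquiv.refl, σ, ρ} : Finset (L ≃ₐ[K] L)).card = 3 :=
    Finset.card_eq_three.2 ⟨_, _, _, hσ.symm, hρ.symm, Ne.symm hne, rfl⟩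
  have h3 := Finset.card_le_univ ({AlgEquiv.refl, σ, ρ} : Finset (L ≃ₐ[K] L))
  have h4 := AlgEquiv.card_le (F := K) (K := L)
  rw [h1] at h3
  have h5 : Fintype.card (L ≃ₐ[K] L) ≤ 2 := h2 ▸ h4
  omega

theorem algEquiv_apply_apply (h2 : Module.finrank K L = 2) {σ : L ≃ₐ[K] L}
    (hσ : σ ≠ AlgEquiv.refl) (y : L) : σ (σ y) = y := by
  by_contra hy
  have hne : σ.trans σ ≠ AlgEquiv.refl := fun h => hy (by
    have := DFunLike.congr_fun h y
    simpa using this)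
  have h1 := algEquiv_eq_of_ne_refl h2 hσ hne
  apply hσ
  ext z
  have := DFunLike.congr_fun h1 z
  exact σ.injective this

theorem exists_algebraMap_eq_of_fixed (h2 : Module.finrank K L = 2) {σ : L ≃ₐ[K] L}
    (hσ : σ ≠ AlgEquiv.refl) {y : L} (hy : σ y = y) : ∃ a : K, algebraMap K L a = y := by
  classical
  have : FiniteDimensional K L := Module.finite_of_finrank_pos (by omega)
  have hcard : Nat.card (L ≃ₐ[K] L) = Module.finrank K L := by
    rw [Nat.card_eq_fintype_card]
    refine le_antisymm AlgEquiv.card_le ?_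
    have h3 := Finset.card_le_univ ({AlgEquiv.refl, σ} : Finset (L ≃ₐ[K] L))
    rw [Finset.card_pair hσ.symm] at h3
    omega
  have := IsGalois.of_card_aut_eq_finrank K L hcard
  have := (IsGalois.mem_bot_iff_fixed (F := K) y).2 fun f => by
    by_cases hf : f = AlgEquiv.refl
    · rw [hf]; rfl
    · rw [algEquiv_eq_of_ne_refl h2 hσ hf, hy]
  exact IntermediateField.mem_bot.1 this

end QuadraticExtension

theorem principalRoot_pow {n : ℕ} (hn : n ≠ 0) (w : ℂ) : principalRoot n w ^ n = w := by
  rw [principalRoot, one_div, Complex.cpow_nat_inv_pow w hn]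

/-! ### Conjugation of the approximations -/

/-- The Galois conjugation multiplies `β₁ (x - β₂) F(Z, U) - β₂ (x - β₁) F(U, Z)` and the
corresponding denominator by `(-1) ^ (r + 1)`, so that a factor `1` or `√τ` moves both of them into
`K`. -/
theorem exists_twist_of_quadratic {K : IntermediateField ℚ ℂ} (hK : IsImaginaryQuadratic K)
    {β₁ β₂ γ₁ γ₂ τ x : ℂ} (h2 : Module.finrank K K⟮β₁⟯ = 2)
    (hβ : IsQuadraticConjugate K β₁ β₁ β₂) (hγ : IsQuadraticConjugate K β₁ γ₁ γ₂)
    (hτK : τ ∈ K) (hτ : IsIntegral ℤ τ) (hL : K⟮β₁⟯ = K⟮principalRoot 2 τ⟯) (hxK : x ∈ K)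
    (n : ℕ) {U Z : ℂ} (hU : U = -γ₂ * (x - β₂) ^ n) (hZ : Z = γ₁ * (x - β₁) ^ n) (r : ℕ) :
    ∃ s : ℂ, s ≠ 0 ∧ IsIntegral ℤ s ∧ ‖s‖ ≤ ‖principalRoot 2 τ‖ ∧
      s * (β₁ * (x - β₂) * hypForm (1 / n) r Z U - β₂ * (x - β₁) * hypForm (1 / n) r U Z) ∈ K ∧
      s * ((x - β₂) * hypForm (1 / n) r Z U - (x - β₁) * hypForm (1 / n) r U Z) ∈ K := by
  obtain ⟨σ, hσ, b, hb, hb'⟩ := hβ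
  obtain ⟨ρ, hρ, c, hc, hc'⟩ := hγ
  obtain rfl := algEquiv_eq_of_ne_refl h2 hσ hρ
  have hσσ := algEquiv_apply_apply h2 hσ
  have hfix : ∀ y : K⟮β₁⟯, ρ y = y → (y : ℂ) ∈ K := fun y hy => by
    obtain ⟨a, rfl⟩ := exists_algebraMap_eq_of_fixed h2 hσ hy
    exact a.2
  set t := principalRoot 2 τ with ht
  have ht2 : t ^ 2 = τ := principalRoot_pow two_ne_zero τ
  have htL : t ∈ K⟮β₁⟯ := by rw [hL]; exact mem_adjoin_simple_self K t
  have htK : t ∉ K := fun h => by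
    have h1 : K⟮t⟯ = ⊥ := adjoin_simple_eq_bot_iff.2 (IntermediateField.mem_bot.2 ⟨⟨t, h⟩, rfl⟩)
    have h3 : Module.finrank K K⟮β₁⟯ = 1 := by rw [hL, h1]; exact IntermediateField.finrank_bot
    omega
  set t' : K⟮β₁⟯ := ⟨t, htL⟩ with ht'
  have ht'2 : t' ^ 2 = algebraMap K K⟮β₁⟯ ⟨τ, hτK⟩ := Subtype.ext ht2
  have hσt : ρ t' = -t' := by
    have h1 : ρ t' ^ 2 = t' ^ 2 := by rw [← map_pow, ht'2, AlgEquiv.commutes]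
    rcases sq_eq_sq_iff_eq_or_eq_neg.1 h1 with h | h
    · exact absurd (hfix t' h) htK
    · exact h
  have ht0 : t ≠ 0 := fun h => htK (h ▸ K.zero_mem)
  have htn : 1 ≤ ‖t‖ := by
    have h1 := one_le_norm_of_isIntegral hK hτK hτ (by rw [← ht2]; exact pow_ne_zero _ ht0)
    rw [← ht2, norm_pow] at h1
    nlinarith [norm_nonneg t]
  have htint : IsIntegral ℤ t := IsIntegral.of_pow two_pos (by rw [ht2]; exact hτ)
  set x' : K⟮β₁⟯ := algebraMap K K⟮β₁⟯ ⟨x, hxK⟩ with hx'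
  have hσx : ρ x' = x' := AlgEquiv.commutes _ _
  set u : K⟮β₁⟯ := -ρ c * (x' - ρ b) ^ n with hu
  set z : K⟮β₁⟯ := c * (x' - b) ^ n with hz
  have hσu : ρ u = -z := by simp [hu, hz, hσx, hσσ]
  have hσz : ρ z = -u := by simp [hu, hz, hσx]
  have hF : ∀ v y : K⟮β₁⟯, ρ (ratForm n r v y) = ratForm n r (ρ v) (ρ y) := fun v y =>
    map_ratForm (ρ : K⟮β₁⟯ →+* K⟮β₁⟯) n r v y
  have hFc : ∀ v y : K⟮β₁⟯, ((ratForm n r v y : K⟮β₁⟯) : ℂ) = hypForm (1 / n) r v y :=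
    fun v y => by
      rw [← ratForm_eq_hypForm]
      exact map_ratForm (algebraMap K⟮β₁⟯ ℂ) n r v y
  have hzc : (z : ℂ) = Z := by
    have : (z : ℂ) = (c : ℂ) * (x - (b : ℂ)) ^ n := rfl
    rw [this, hb, hc, hZ]
  have huc : (u : ℂ) = U := by
    have : (u : ℂ) = -((ρ c : K⟮β₁⟯) : ℂ) * (x - ((ρ b : K⟮β₁⟯) : ℂ)) ^ n := rfl
    rw [this, hb', hc', hU]
  set P : K⟮β₁⟯ := b * (x' - ρ b) * ratForm n r z u - ρ b * (x' - b) * ratForm n r u z with hP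
  set R : K⟮β₁⟯ := (x' - ρ b) * ratForm n r z u - (x' - b) * ratForm n r u z with hR
  have hσP : ρ P = -(-1) ^ r * P := by
    simp only [hP, map_sub, map_mul, hF, hσu, hσz, hσx, hσσ, ratForm_neg_neg]; ring
  have hσR : ρ R = -(-1) ^ r * R := by
    simp only [hR, map_sub, map_mul, hF, hσu, hσz, hσx, hσσ, ratForm_neg_neg]; ring
  have hPc : (P : ℂ) = β₁ * (x - β₂) * hypForm (1 / n) r Z U -
      β₂ * (x - β₁) * hypForm (1 / n) r U Z := by
    have : (P : ℂ) = b * (x - (ρ b : K⟮β₁⟯)) * (ratForm n r z u : K⟮β₁⟯) -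
        (ρ b : K⟮β₁⟯) * (x - b) * (ratForm n r u z : K⟮β₁⟯) := rfl
    rw [this, hFc, hFc, hb, hb', hzc, huc]
  have hRc : (R : ℂ) = (x - β₂) * hypForm (1 / n) r Z U - (x - β₁) * hypForm (1 / n) r U Z := by
    have : (R : ℂ) = (x - (ρ b : K⟮β₁⟯)) * (ratForm n r z u : K⟮β₁⟯) -
        (x - b) * (ratForm n r u z : K⟮β₁⟯) := rfl
    rw [this, hFc, hFc, hb, hb', hzc, huc]
  rw [← hPc, ← hRc]
  rcases Nat.even_or_odd r with hr | hr
  · rw [hr.neg_one_pow] at hσP hσR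
    refine ⟨t, ht0, htint, le_rfl, ?_, ?_⟩
    · exact hfix (t' * P) (by rw [map_mul, hσt, hσP]; ring)
    · exact hfix (t' * R) (by rw [map_mul, hσt, hσR]; ring)
  · rw [hr.neg_one_pow] at hσP hσR
    refine ⟨1, one_ne_zero, isIntegral_one, by simpa using htn, ?_, ?_⟩
    · rw [one_mul]; exact hfix P (by rw [hσP]; ring)
    · rw [one_mul]; exact hfix R (by rw [hσR]; ring)

theorem conjugate_ne {K : IntermediateField ℚ ℂ} {β₁ β₂ : ℂ}
    (hβ : IsQuadraticConjugate K β₁ β₁ β₂) : β₂ ≠ β₁ := by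
  obtain ⟨σ, hσ, b, hb, hb'⟩ := hβ
  rintro rfl
  have hσb : σ b = b := Subtype.ext (hb'.trans hb.symm)
  have hgen : b = AdjoinSimple.gen K β₂ := Subtype.ext hb
  have h1 : σ.toAlgHom = AlgHom.id K K⟮β₂⟯ :=
    IntermediateField.adjoin_algHom_ext K fun y hy => by
      obtain rfl : y = β₂ := by simpa using hy
      rw [hgen] at hσb
      exact hσb
  exact hσ (AlgEquiv.ext fun y => DFunLike.congr_fun h1 y)

theorem isIntegral_conjugate {K : IntermediateField ℚ ℂ} {β z z' : ℂ}
    (h : IsQuadraticConjugate K β z z') (hz : IsIntegral ℤ z) : IsIntegral ℤ z' := by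
  obtain ⟨σ, -, y, rfl, rfl⟩ := h
  have h1 : IsIntegral ℤ y :=
    (isIntegral_algebraMap_iff (algebraMap K⟮β⟯ ℂ).injective).1 hz
  have h2 : IsIntegral ℤ (σ y) := h1.map (σ.toRingEquiv.toRingHom.toIntAlgHom)
  exact h2.map (algebraMap K⟮β⟯ ℂ).toIntAlgHom

/-! ### Lower bounds from sequences of approximations -/

/-- Denominators of a sequence of pairwise distinct consecutive approximations from an imaginary
quadratic field cannot decay geometrically, since they would have to vanish eventually. -/
theorem not_geometric_decay {K : IntermediateField ℚ ℂ} (hK : IsImaginaryQuadratic K)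
    {p q : ℕ → ℂ} (hqK : ∀ r, q r ∈ K) (hq : ∀ r, IsIntegral ℤ (q r))
    (hdet : ∀ r, p r * q (r + 1) ≠ p (r + 1) * q r) {M ρ : ℝ} (hρ0 : 0 ≤ ρ) (hρ : ρ < 1)
    (hle : ∀ r, ‖q r‖ ≤ M * ρ ^ r) : False := by
  have hlim : Filter.Tendsto (fun r : ℕ => M * ρ ^ r) Filter.atTop (nhds 0) := by
    simpa using (tendsto_pow_atTop_nhds_zero_of_lt_one hρ0 hρ).const_mul M
  obtain ⟨R, hR⟩ := Filter.eventually_atTop.1 (hlim.eventually_lt_const one_pos)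
  have h0 : ∀ r, R ≤ r → q r = 0 := fun r hr => by
    by_contra hne
    have := one_le_norm_of_isIntegral hK (hqK r) (hq r) hne
    linarith [hle r, hR r hr]
  exact hdet R (by rw [h0 R le_rfl, h0 (R + 1) (by omega)]; simp)

/-- An effective irrationality measure over an imaginary quadratic field `K` from a sequence of good
approximations `p r / q r` to `θ`. -/
theorem lower_bound_of_approximations {K : IntermediateField ℚ ℂ} (hK : IsImaginaryQuadratic K)
    {θ : ℂ} {p q : ℕ → ℂ} (hpK : ∀ r, p r ∈ K) (hp : ∀ r, IsIntegral ℤ (p r))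
    (hqK : ∀ r, q r ∈ K) (hq : ∀ r, IsIntegral ℤ (q r))
    (hdet : ∀ r, p r * q (r + 1) ≠ p (r + 1) * q r) {k l E Q : ℝ} (hk : 0 < k) (hl : 0 ≤ l)
    (hE : 1 < E) (hQ : 0 < Q) (hqle : ∀ r, ‖q r‖ ≤ k * Q ^ r)
    (hle : ∀ r, ‖q r * θ - p r‖ ≤ l * E⁻¹ ^ r) {a b : ℂ} (haK : a ∈ K) (ha : IsIntegral ℤ a)
    (hbK : b ∈ K) (hb : IsIntegral ℤ b) (hb0 : b ≠ 0) :
    1 / (4 * k * Q * max 1 (2 * l * E) ^ (Real.log Q / Real.log E) *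
      ‖b‖ ^ (Real.log Q / Real.log E + 1)) < ‖θ - a / b‖ := by
  have hE0 : 0 < E := by linarith
  have hQ1 : 1 ≤ Q := by
    by_contra hlt
    exact not_geometric_decay hK hqK hq hdet hQ.le (not_le.1 hlt) hqle
  have hlogE : 0 < Real.log E := Real.log_pos hE
  set κ := Real.log Q / Real.log E with hκdef
  have hκ : 0 ≤ κ := div_nonneg (Real.log_nonneg hQ1) hlogE.le
  have hEκ : E ^ κ = Q := by
    rw [Real.rpow_def_of_pos hE0, hκdef, mul_div_cancel₀ _ hlogE.ne', Real.exp_log hQ]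
  have hb1 : 1 ≤ ‖b‖ := one_le_norm_of_isIntegral hK hbK hb hb0
  have hbpos : 0 < ‖b‖ := by linarith
  have hM1 : 1 ≤ max 1 (2 * l * E) := le_max_left _ _
  have hEinv : E⁻¹ < 1 := inv_lt_one_of_one_lt₀ hE
  have hEinv0 : 0 < E⁻¹ := inv_pos.2 hE0
  have hex : ∃ r : ℕ, 2 * l * ‖b‖ * E⁻¹ ^ r < 1 := by
    have hlim : Filter.Tendsto (fun r : ℕ => 2 * l * ‖b‖ * E⁻¹ ^ r) Filter.atTop (nhds 0) := by
      simpa using (tendsto_pow_atTop_nhds_zero_of_lt_one hEinv0.le hEinv).const_mul (2 * l * ‖b‖)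
    exact (hlim.eventually_lt_const one_pos).exists
  classical
  set r₀ := Nat.find hex with hr₀
  have hspec : 2 * l * ‖b‖ * E⁻¹ ^ r₀ < 1 := Nat.find_spec hex
  -- minimality of `r₀` bounds `Q ^ r₀`
  have hQr : Q ^ r₀ ≤ max 1 (2 * l * E) ^ κ * ‖b‖ ^ κ := by
    rw [← Real.mul_rpow (by linarith) hbpos.le, ← hEκ, ← Real.rpow_mul_natCast hE0.le,
      mul_comm κ, Real.rpow_natCast_mul hE0.le]
    refine Real.rpow_le_rpow (by positivity) ?_ hκ
    rcases hcase : r₀ with _ | s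
    · rw [pow_zero]; nlinarith
    · have hmin : ¬ 2 * l * ‖b‖ * E⁻¹ ^ s < 1 := Nat.find_min hex (by omega)
      have h1 : E ^ s ≤ 2 * l * ‖b‖ := by
        rw [not_lt, inv_pow, ← div_eq_mul_inv, le_div_iff₀ (by positivity), one_mul] at hmin
        exact hmin
      calc E ^ (s + 1) = E ^ s * E := pow_succ _ _
        _ ≤ 2 * l * ‖b‖ * E := mul_le_mul_of_nonneg_right h1 hE0.le
        _ = (2 * l * E) * ‖b‖ := by ring
        _ ≤ _ := mul_le_mul_of_nonneg_right (le_max_right _ _) hbpos.le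
  -- one of two consecutive approximations differs from `a / b`
  obtain ⟨r, hr1, hr2, hne⟩ : ∃ r, r₀ ≤ r ∧ r ≤ r₀ + 1 ∧ p r * b - a * q r ≠ 0 := by
    by_contra hcon
    push Not at hcon
    have h1 := hcon r₀ le_rfl (by omega)
    have h2 := hcon (r₀ + 1) (by omega) le_rfl
    refine hdet r₀ (mul_right_cancel₀ hb0 ?_)
    linear_combination q (r₀ + 1) * h1 - q r₀ * h2
  have h1 : 1 ≤ ‖p r * b - a * q r‖ := by
    refine one_le_norm_of_isIntegral hK ?_ ?_ hne
    · exact K.sub_mem (K.mul_mem (hpK r) hbK) (K.mul_mem haK (hqK r))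
    · exact ((hp r).mul hb).sub (ha.mul (hq r))
  have h2 : p r * b - a * q r = -(b * (q r * θ - p r)) + q r * (b * (θ - a / b)) := by
    field_simp; ring
  have h3 : ‖p r * b - a * q r‖ ≤ ‖b‖ * (l * E⁻¹ ^ r) + ‖q r‖ * (‖b‖ * ‖θ - a / b‖) := by
    rw [h2]
    refine (norm_add_le _ _).trans ?_
    rw [norm_neg, norm_mul, norm_mul, norm_mul]
    gcongr
    exact hle r
  have h4 : E⁻¹ ^ r ≤ E⁻¹ ^ r₀ := pow_le_pow_of_le_one hEinv0.le hEinv.le hr1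
  have h5 : ‖b‖ * (l * E⁻¹ ^ r) < 1 / 2 := by
    have : ‖b‖ * (l * E⁻¹ ^ r) ≤ ‖b‖ * (l * E⁻¹ ^ r₀) := by gcongr
    nlinarith
  have h6 : ‖q r‖ ≤ k * (Q * (max 1 (2 * l * E) ^ κ * ‖b‖ ^ κ)) := by
    refine (hqle r).trans (mul_le_mul_of_nonneg_left ?_ hk.le)
    calc Q ^ r ≤ Q ^ (r₀ + 1) := pow_le_pow_right₀ hQ1 hr2
      _ = Q * Q ^ r₀ := by ring
      _ ≤ _ := mul_le_mul_of_nonneg_left hQr hQ.le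
  have h7 : ‖q r‖ * (‖b‖ * ‖θ - a / b‖) ≤
      k * (Q * (max 1 (2 * l * E) ^ κ * ‖b‖ ^ κ)) * (‖b‖ * ‖θ - a / b‖) := by gcongr
  have hMκ : 0 < max 1 (2 * l * E) ^ κ := Real.rpow_pos_of_pos (by linarith) _
  have hbκ : 0 < ‖b‖ ^ κ := Real.rpow_pos_of_pos hbpos _
  rw [Real.rpow_add_one hbpos.ne', div_lt_iff₀ (by positivity)]
  nlinarith

/-! ### The effective irrationality measure -/

theorem norm_natCast_div_natCast (a b : ℕ) : ‖(a : ℂ) / b‖ = (a : ℝ) / b := by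
  rw [norm_div, Complex.norm_natCast, Complex.norm_natCast]

theorem numerBase_pos (d n : ℕ) : 0 < numerBase d n :=
  Finset.prod_pos fun p hp => Real.rpow_pos_of_pos
    (by exact_mod_cast (Nat.prime_of_mem_primeFactors hp).pos) _

theorem one_half_lt_re {w : ℂ} (hw0 : w ≠ 0) (h : ‖1 - 1 / w‖ < 1) : 1 / 2 < w.re := by
  have hn : 0 < ‖w‖ := norm_pos_iff.2 hw0
  have h1 : ‖w - 1‖ < ‖w‖ := by
    have e : 1 - 1 / w = (w - 1) / w := by field_simp
    rwa [e, norm_div, div_lt_one hn] at h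
  have h2 : ‖w - 1‖ ^ 2 < ‖w‖ ^ 2 := by
    have := norm_nonneg (w - 1); nlinarith
  rw [Complex.sq_norm, Complex.sq_norm, Complex.normSq_apply, Complex.normSq_apply] at h2
  simp only [Complex.sub_re, Complex.sub_im, Complex.one_re, Complex.one_im] at h2
  nlinarith

theorem theorem2p2
    (K : IntermediateField ℚ ℂ) (hK : IsImaginaryQuadratic K)
    (β₁ β₂ γ₁ γ₂ τ : ℂ) (hβ₁ : IsIntegral ℤ β₁)
    (hβγτ :
      (β₁ ∈ K ∧ β₂ ∈ K ∧ γ₁ ∈ K ∧ γ₂ ∈ K ∧ γ₁ ≠ 0 ∧ γ₂ ≠ 0 ∧ β₂ ≠ β₁ ∧ IsIntegral ℤ β₂ ∧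
        τ = 1) ∨
      (Module.finrank K K⟮β₁⟯ = 2 ∧
        IsQuadraticConjugate K β₁ β₁ β₂ ∧ IsQuadraticConjugate K β₁ γ₁ γ₂ ∧
        τ ∈ K ∧ IsIntegral ℤ τ ∧ K⟮β₁⟯ = K⟮principalRoot 2 τ⟯))
    (x : ℂ) (hxK : x ∈ K) (hx : IsIntegral ℤ x)
    (n : ℕ) (hn : 3 ≤ n)
    (U Z W A : ℂ)
    (hU : U = -γ₂ * (x - β₂) ^ n)
    (hZ : Z = γ₁ * (x - β₁) ^ n)
    (hW : W = Z / U)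
    (hA : A = (β₁ * (x - β₂) * principalRoot n W - β₂ * (x - β₁)) /
      ((x - β₂) * principalRoot n W - (x - β₁)))
    (g : ℂ) (hg : IsAlgebraic ℚ g) (hg0 : g ≠ 0)
    (hUg : IsIntegral ℤ (U / g)) (hZg : IsIntegral ℤ (Z / g))
    (hseq : ℕ → ℂ) (h : ℝ)
    (hseq_ne : ∀ r, hseq r ≠ 0) (hseq_int : ∀ r, IsIntegral ℤ (hseq r))
    (hseq_mem : ∀ r, hseq r / g ^ r ∈ K) (hpos : 0 < h) (hseq_le : ∀ r, ‖hseq r‖ ≤ h)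
    (d : ℕ) (hd : IsGreatest {k : ℕ | 0 < k ∧ IsIntegral ℤ ((U - Z) / ((k : ℂ) * g))} d)
    (Cn Dn : ℝ) (hCn : 0 < Cn) (hDn : 0 < Dn) (hbound : DenomBound n d Cn Dn)
    (E Q κ c : ℝ)
    (hE : E = ‖g‖ * numerBase d n / Dn * (4 * (‖U‖ - ‖Z - U‖) / ‖Z - U‖ ^ 2))
    (hQ : Q = Dn / (‖g‖ * numerBase d n) * (2 * (‖U‖ + ‖Z‖)))
    (hκ : κ = Real.log Q / Real.log E)
    (hc : c = 4 * h * ‖principalRoot 2 τ‖ * (‖x - β₁‖ + ‖x - β₂‖) * Cn * Q *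
      (max 1 (2 * h * ‖principalRoot 2 τ‖ * ‖1 - principalRoot n W‖ * ‖x - β₂‖ *
        ‖A - β₁‖ * Cn * E)) ^ κ)
    (hE1 : 1 < E) (hW1 : max ‖1 - W‖ ‖1 - 1 / W‖ < 1) :
    (x - β₂) * principalRoot n W - (x - β₁) ≠ 0 ∧
    ∀ p q : ℂ, p ∈ K → IsIntegral ℤ p → q ∈ K → IsIntegral ℤ q → q ≠ 0 →
      ‖A - p / q‖ > 1 / (c * ‖q‖ ^ (κ + 1)) := by
  have hn' : (3 : ℝ) ≤ n := by exact_mod_cast hn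
  have hν : (0 : ℝ) < 1 / n := by positivity
  have hν2 : (1 : ℝ) / n < 1 / 2 := one_div_lt_one_div_of_lt two_pos (by linarith)
  have hν1 : (1 : ℝ) / n < 1 := by linarith
  have hWa : ‖W - 1‖ < 1 := by
    rw [norm_sub_rev]; exact (max_lt_iff.1 hW1).1
  have hW0 : W ≠ 0 := by
    rintro rfl; simp at hWa
  have hre : 1 / 2 < W.re := one_half_lt_re hW0 (max_lt_iff.1 hW1).2
  have hU0 : U ≠ 0 := by
    intro h0; rw [h0, div_zero] at hW; exact hW0 hW
  have hZ0 : Z ≠ 0 := by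
    intro h0; rw [h0, zero_div] at hW; exact hW0 hW
  have hZW : Z = U * W := by rw [hW]; field_simp
  have hx1 : x - β₁ ≠ 0 := fun h0 => hZ0 (by rw [hZ, h0, zero_pow (by omega), mul_zero])
  have hx2 : x - β₂ ≠ 0 := fun h0 => hU0 (by rw [hU, h0, zero_pow (by omega), mul_zero])
  obtain ⟨⟨hd0, hdint⟩, hdmax⟩ := hd
  -- for `U = Z` there would be no greatest `d`
  have hUZ : Z - U ≠ 0 := fun h0 => by
    have h1 : d + 1 ≤ d := hdmax ⟨by omega, by
      rw [← neg_sub, h0, neg_zero, zero_div]; exact isIntegral_zero⟩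
    omega
  have hWne : W ≠ 1 := fun h0 => hUZ (by rw [hZW, h0]; ring)
  set ω := principalRoot n W with hω
  have hωcpow : W ^ (((1 : ℝ) / n : ℝ) : ℂ) = ω := by
    rw [hω, principalRoot]; push_cast; rfl
  obtain ⟨hβne, hβ₂, htwist⟩ : β₂ ≠ β₁ ∧ IsIntegral ℤ β₂ ∧ ∀ r, ∃ s : ℂ, s ≠ 0 ∧ IsIntegral ℤ s ∧
      ‖s‖ ≤ ‖principalRoot 2 τ‖ ∧
      s * (β₁ * (x - β₂) * hypForm (1 / n) r Z U - β₂ * (x - β₁) * hypForm (1 / n) r U Z) ∈ K ∧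
      s * ((x - β₂) * hypForm (1 / n) r Z U - (x - β₁) * hypForm (1 / n) r U Z) ∈ K := by
    rcases hβγτ with ⟨hb1, hb2, hg1, hg2, -, -, hne, hint, rfl⟩ | ⟨h2, hβ, hγ, hτK, hτ, hL⟩
    · refine ⟨hne, hint, fun r => ⟨1, one_ne_zero, isIntegral_one, ?_, ?_, ?_⟩⟩
      · simp [principalRoot]
      all_goals
        have hUK : U ∈ K := by
          rw [hU]; exact K.mul_mem (K.neg_mem hg2) (K.pow_mem (K.sub_mem hxK hb2) n)
        have hZK : Z ∈ K := by
          rw [hZ]; exact K.mul_mem hg1 (K.pow_mem (K.sub_mem hxK hb1) n)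
        have hF1 := hypForm_mem hZK hUK n r
        have hF2 := hypForm_mem hUK hZK n r
        rw [one_mul]
      · exact K.sub_mem (K.mul_mem (K.mul_mem hb1 (K.sub_mem hxK hb2)) hF1)
          (K.mul_mem (K.mul_mem hb2 (K.sub_mem hxK hb1)) hF2)
      · exact K.sub_mem (K.mul_mem (K.sub_mem hxK hb2) hF1) (K.mul_mem (K.sub_mem hxK hb1) hF2)
    · exact ⟨conjugate_ne hβ, isIntegral_conjugate hβ hβ₁,
        exists_twist_of_quadratic hK h2 hβ hγ hτK hτ hL hxK n hU hZ⟩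
  choose s hs0 hsint hsle hsP hsQ using htwist
  set t := ‖principalRoot 2 τ‖ with ht
  have ht0 : 0 < t := (norm_pos_iff.2 (hs0 0)).trans_le (hsle 0)
  set F : ℕ → ℂ := fun r => hypForm (1 / n) r Z U with hF
  set G : ℕ → ℂ := fun r => hypForm (1 / n) r U Z with hG
  set T : ℕ → ℂ := fun r => (hypDenom n r : ℂ) / hypNumer d n r with hT
  have hT0 : ∀ r, T r ≠ 0 := fun r => div_ne_zero
    (by exact_mod_cast (hypDenom_spec n r).1.ne') (by exact_mod_cast hypNumer_ne_zero hd0 n r)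
  have hTK : ∀ r, T r ∈ K := fun r => K.div_mem (K.natCast_mem _) (K.natCast_mem _)
  have hTn : ∀ r, ‖T r‖ = (hypDenom n r : ℝ) / hypNumer d n r :=
    fun r => norm_natCast_div_natCast _ _
  set v : ℕ → ℂ := fun r => s r * (hseq r / g ^ r) * T r with hv
  have hv0 : ∀ r, v r ≠ 0 := fun r =>
    mul_ne_zero (mul_ne_zero (hs0 r) (div_ne_zero (hseq_ne r) (pow_ne_zero _ hg0))) (hT0 r)
  set p : ℕ → ℂ := fun r => v r * (β₁ * (x - β₂) * F r - β₂ * (x - β₁) * G r) with hp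
  set q : ℕ → ℂ := fun r => v r * ((x - β₂) * F r - (x - β₁) * G r) with hq
  have hFint : ∀ r, IsIntegral ℤ (T r * F r / g ^ r) := fun r =>
    isIntegral_denom_div_numer_mul_hypForm hd0 hU0 hg0 hUg hdint
  have hGint : ∀ r, IsIntegral ℤ (T r * G r / g ^ r) := fun r =>
    isIntegral_denom_div_numer_mul_hypForm hd0 hZ0 hg0 hZg (by
      rw [← neg_sub, neg_div]; exact hdint.neg)
  have hpK : ∀ r, p r ∈ K := fun r => by
    have : p r = (s r * (β₁ * (x - β₂) * F r - β₂ * (x - β₁) * G r)) *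
        (hseq r / g ^ r) * T r := by simp only [hp, hv]; ring
    rw [this]
    exact K.mul_mem (K.mul_mem (hsP r) (hseq_mem r)) (hTK r)
  have hqK : ∀ r, q r ∈ K := fun r => by
    have : q r = (s r * ((x - β₂) * F r - (x - β₁) * G r)) * (hseq r / g ^ r) * T r := by
      simp only [hq, hv]; ring
    rw [this]
    exact K.mul_mem (K.mul_mem (hsQ r) (hseq_mem r)) (hTK r)
  have hpint : ∀ r, IsIntegral ℤ (p r) := fun r => by
    have : p r = s r * hseq r * (β₁ * (x - β₂) * (T r * F r / g ^ r) -
        β₂ * (x - β₁) * (T r * G r / g ^ r)) := by simp only [hp, hv]; ring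
    rw [this]
    exact ((hsint r).mul (hseq_int r)).mul (((hβ₁.mul (hx.sub hβ₂)).mul (hFint r)).sub
      ((hβ₂.mul (hx.sub hβ₁)).mul (hGint r)))
  have hqint : ∀ r, IsIntegral ℤ (q r) := fun r => by
    have : q r = s r * hseq r * ((x - β₂) * (T r * F r / g ^ r) -
        (x - β₁) * (T r * G r / g ^ r)) := by simp only [hq, hv]; ring
    rw [this]
    exact ((hsint r).mul (hseq_int r)).mul (((hx.sub hβ₂).mul (hFint r)).sub
      ((hx.sub hβ₁).mul (hGint r)))
  have hFW : ∀ r, F r = U ^ r * hypForm (1 / n) r W 1 := fun r => by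
    have := hypForm_mul_mul (1 / n) r U W 1
    rwa [mul_one, ← hZW] at this
  have hGW : ∀ r, G r = U ^ r * hypForm (1 / n) r 1 W := fun r => by
    have := hypForm_mul_mul (1 / n) r U 1 W
    rwa [mul_one, ← hZW] at this
  have hdet : ∀ r, p r * q (r + 1) ≠ p (r + 1) * q r := fun r => by
    have h1 := hypForm_det_ne_zero hν hν1 r hWne
    have h2 : p r * q (r + 1) - p (r + 1) * q r = v r * v (r + 1) * (U ^ r * U ^ (r + 1)) *
        ((β₂ - β₁) * (x - β₁) * (x - β₂)) *
        (hypForm (1 / n) r W 1 * hypForm (1 / n) (r + 1) 1 W -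
          hypForm (1 / n) (r + 1) W 1 * hypForm (1 / n) r 1 W) := by
      simp only [hp, hq, hFW, hGW]; ring
    rw [← sub_ne_zero, h2]
    exact mul_ne_zero (mul_ne_zero (mul_ne_zero (mul_ne_zero (hv0 _) (hv0 _))
      (mul_ne_zero (pow_ne_zero _ hU0) (pow_ne_zero _ hU0)))
      (mul_ne_zero (mul_ne_zero (sub_ne_zero.2 hβne) hx1) hx2)) h1
  have hgn : 0 < ‖g‖ := norm_pos_iff.2 hg0
  have hUn : 0 < ‖U‖ := norm_pos_iff.2 hU0
  have hUZn : 0 < ‖Z - U‖ := norm_pos_iff.2 hUZ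
  have hNB : 0 < numerBase d n := numerBase_pos d n
  have hsplit : Dn / (‖g‖ * numerBase d n) = Dn / numerBase d n / ‖g‖ := by field_simp
  have hvle : ∀ r, ‖v r‖ ≤ t * (h / ‖g‖ ^ r) * ‖T r‖ := fun r => by
    simp only [hv]
    rw [norm_mul, norm_mul, norm_div, norm_pow]
    gcongr
    · exact hsle r
    · exact hseq_le r
  -- the two halves of the bound for the denominators `D_{n,r} / N_{d,n,r}`
  have hTa : ∀ r, r.factorial / (∏ m ∈ Finset.range r, ((m : ℝ) + 1 - 1 / n)) * ‖T r‖ ≤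
      Cn * (Dn / numerBase d n) ^ r := fun r => by
    rw [hTn, ← gamma_ratio_left (by omega)]
    refine le_trans ?_ (hbound r).le
    gcongr
    exact (le_max_left _ _).trans (le_max_right _ _)
  have hTb : ∀ r, (∏ i ∈ Finset.range (r + 1), ((1 : ℝ) / n + i)) / (1 / n * r.factorial) *
      ‖T r‖ ≤ Cn * (Dn / numerBase d n) ^ r := fun r => by
    rw [hTn, ← gamma_ratio_right (by omega)]
    refine le_trans ?_ (hbound r).le
    gcongr
    exact (le_max_right _ _).trans (le_max_right _ _)
  have hqle : ∀ r, ‖q r‖ ≤ h * t * (‖x - β₁‖ + ‖x - β₂‖) * Cn * Q ^ r := fun r => by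
    have hFle := norm_hypForm_le hν hν2 r Z U
    have hGle := norm_hypForm_le hν hν2 r U Z
    rw [add_comm ‖Z‖] at hFle
    have hep := prod_add_one_sub_pos hν1 r
    set e := (r.factorial : ℝ) / ∏ m ∈ Finset.range r, ((m : ℝ) + 1 - 1 / n)
    have h1 : ‖(x - β₂) * F r - (x - β₁) * G r‖ ≤
        (‖x - β₁‖ + ‖x - β₂‖) * (e * (2 * (‖U‖ + ‖Z‖)) ^ r) := by
      refine (norm_sub_le _ _).trans ?_
      rw [norm_mul, norm_mul]
      nlinarith [mul_le_mul_of_nonneg_left hFle (norm_nonneg (x - β₂)),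
        mul_le_mul_of_nonneg_left hGle (norm_nonneg (x - β₁))]
    calc ‖q r‖ = ‖v r‖ * ‖(x - β₂) * F r - (x - β₁) * G r‖ := norm_mul _ _
      _ ≤ (t * (h / ‖g‖ ^ r) * ‖T r‖) *
          ((‖x - β₁‖ + ‖x - β₂‖) * (e * (2 * (‖U‖ + ‖Z‖)) ^ r)) := by
          gcongr; exact hvle r
      _ = (t * (h / ‖g‖ ^ r) * (‖x - β₁‖ + ‖x - β₂‖) * (2 * (‖U‖ + ‖Z‖)) ^ r) *
          (e * ‖T r‖) := by ring
      _ ≤ (t * (h / ‖g‖ ^ r) * (‖x - β₁‖ + ‖x - β₂‖) * (2 * (‖U‖ + ‖Z‖)) ^ r) *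
          (Cn * (Dn / numerBase d n) ^ r) :=
          mul_le_mul_of_nonneg_left (hTa r) (by positivity)
      _ = _ := by
          rw [hQ, hsplit, mul_pow (_ / _), div_pow _ ‖g‖]; ring
  -- the error term
  set ε : ℕ → ℂ := fun r => v r * (F r - ω * G r) with hε
  have hWn : ‖W - 1‖ = ‖Z - U‖ / ‖U‖ := by
    rw [← norm_div, hW]; congr 1; field_simp
  have hlt : ‖Z - U‖ < ‖U‖ := by rwa [hWn, div_lt_one hUn] at hWa
  have hlt' : 0 < ‖U‖ - ‖Z - U‖ := sub_pos.2 hlt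
  have hEinv : E⁻¹ = Dn / (‖g‖ * numerBase d n) *
      (‖U‖ * (‖W - 1‖ ^ 2 / (4 * (1 - ‖W - 1‖)))) := by
    have h1 : 1 - ‖Z - U‖ / ‖U‖ = (‖U‖ - ‖Z - U‖) / ‖U‖ := by field_simp
    rw [hE, hWn, h1]
    field_simp
  have hεle : ∀ r, ‖ε r‖ ≤ h * t * ‖1 - ω‖ * Cn * E⁻¹ ^ r := fun r => by
    have h1 := norm_hypForm_sub_le hν hν1 r hWa hre
    rw [hωcpow] at h1
    have hPp : 0 < ∏ i ∈ Finset.range (r + 1), ((1 : ℝ) / n + i) :=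
      Finset.prod_pos fun i _ => by positivity
    set e := (∏ i ∈ Finset.range (r + 1), ((1 : ℝ) / n + i)) / (1 / n * r.factorial)
    have hz : 0 < 1 - ‖W - 1‖ := sub_pos.2 hWa
    set y := ‖W - 1‖ ^ 2 / (4 * (1 - ‖W - 1‖)) with hy
    have hy0 : 0 ≤ y := by positivity
    have h2 : ‖F r - ω * G r‖ ≤ ‖U‖ ^ r * (e * ‖1 - ω‖ * y ^ r) := by
      have : F r - ω * G r = U ^ r *
          (hypForm (1 / n) r W 1 - ω * hypForm (1 / n) r 1 W) := by rw [hFW, hGW]; ring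
      rw [this, norm_mul, norm_pow]
      gcongr
    calc ‖ε r‖ = ‖v r‖ * ‖F r - ω * G r‖ := norm_mul _ _
      _ ≤ (t * (h / ‖g‖ ^ r) * ‖T r‖) * (‖U‖ ^ r * (e * ‖1 - ω‖ * y ^ r)) := by
          gcongr; exact hvle r
      _ = (t * (h / ‖g‖ ^ r) * ‖U‖ ^ r * ‖1 - ω‖ * y ^ r) * (e * ‖T r‖) := by ring
      _ ≤ (t * (h / ‖g‖ ^ r) * ‖U‖ ^ r * ‖1 - ω‖ * y ^ r) *
          (Cn * (Dn / numerBase d n) ^ r) :=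
          mul_le_mul_of_nonneg_left (hTb r) (by positivity)
      _ = _ := by
          rw [hEinv, hsplit, mul_pow (_ / _), div_pow _ ‖g‖, mul_pow]; ring
  have hE0 : 0 < E := by linarith
  -- with a vanishing denominator, the `q r` would be multiples of the error terms
  have hΔ : (x - β₂) * ω - (x - β₁) ≠ 0 := fun h0 => by
    refine not_geometric_decay hK hqK hqint hdet (M := ‖x - β₂‖ * (h * t * ‖1 - ω‖ * Cn))
      (ρ := E⁻¹) (inv_pos.2 hE0).le (inv_lt_one_of_one_lt₀ hE1) fun r => ?_
    have : q r = (x - β₂) * ε r := by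
      simp only [hq, hε]; linear_combination v r * G r * h0
    rw [this, norm_mul, mul_assoc]
    exact mul_le_mul_of_nonneg_left (hεle r) (norm_nonneg _)
  refine ⟨hΔ, fun a b haK ha hbK hb hb0 => ?_⟩
  have hAΔ : A * ((x - β₂) * ω - (x - β₁)) = β₁ * (x - β₂) * ω - β₂ * (x - β₁) := by
    rw [hA, div_mul_cancel₀ _ hΔ]
  have hkpos : 0 < ‖x - β₁‖ + ‖x - β₂‖ :=
    add_pos (norm_pos_iff.2 hx1) (norm_pos_iff.2 hx2)
  have hQ0 : 0 < Q := by rw [hQ]; positivity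
  have hmain := lower_bound_of_approximations hK (θ := A) hpK hpint hqK hqint hdet
    (k := h * t * (‖x - β₁‖ + ‖x - β₂‖) * Cn)
    (l := h * t * ‖1 - ω‖ * ‖x - β₂‖ * ‖A - β₁‖ * Cn) (by positivity) (by positivity) hE1 hQ0 hqle
    (fun r => by
      have : q r * A - p r = (x - β₂) * (A - β₁) * ε r := by
        simp only [hq, hp, hε]; linear_combination v r * G r * hAΔ
      rw [this, norm_mul, norm_mul]
      calc _ ≤ ‖x - β₂‖ * ‖A - β₁‖ * (h * t * ‖1 - ω‖ * Cn * E⁻¹ ^ r) := by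
            gcongr; exact hεle r
        _ = _ := by ring) haK ha hbK hb hb0
  rw [gt_iff_lt, hc, hκ]
  convert! hmain using 5
  · ring
  · ring_nf
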